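/- **Conventions.** Fix a field $\mathbb K$. A *Hom-Leibniz algebra* $(\mathfrak g,\alpha)$ is a $\mathbb K$-vector space with a bilinear product $[\cdot,\cdot]$ and a linear map $\alpha:\mathfrak g\to\mathfrak g$ such that $\alpha[x,y]=[\alpha x,\alpha y]$ and $[\alpha x,[y,z]]=[[x,y],\alpha z]-[[x,z],\alpha y]$. Homomorphisms are linear maps preserving the product and commuting with the maps $\alpha$. Subalgebras and (two-sided) ideals are required to be $\alpha$-invariant. A subspace is *central* if it lies in $Z(\mathfrak g)=\{x: [x,y]=[y,x]=0\ \forall y\in\mathfrak g\}$ (a central subalgebra is then an ideal), and $Z_\alpha(\mathfrak g)=\{x:\alpha^k(x)\in Z(\mathfrak g)\ \forall k\ge 0\}$. For ideals $\mathfrak a,\mathfrak b$, $[\mathfrak a,\mathfrak b]$ is the span of all $[a,b]$ and $[b,a]$ with $a\in\mathfrak a$, $b\in\mathfrak b$. A *free* Hom-Leibniz algebra is the free Hom-Leibniz algebra over a Hom-vector space, i.e. a vector space $V$ with a linear self-map (the left adjoint of the forgetful functor, evaluated at $V$), and a *free presentation* of $\mathfrak g$ is a surjective homomorphism $\pi:F\to\mathfrak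 g$ with $F$ free and $R=\ker\pi$. The *tensor product* $\mathfrak g*\mathfrak g$ is the Hom-Leibniz algebra generated by two families of symbols $x*_1y$ and $x*_2y$ ($x,y\in\mathfrak g$; in $x*_1y$ the entry $x$ is taken from the first factor and $y$ from the second, in $x*_2y$ it is the other way round), subject to the following relations for all $x,y,z,w\in\mathfrak g$ and $i,j,k\in\{1,2\}$: (1), (2) $x*_iy$ is bilinear in $(x,y)$; (3) $\alpha x*_i[y,z]=-\alpha x*_i[z,y]$; (4) $\alpha x*_i[y,z]=[x,y]*_i\alpha z-[x,z]*_i\alpha y$, and $[x,y]*_i\alpha z=[x,z]*_j\alpha y-\alpha x*_i[z,y]$ if $i\ne j$; (5) $[x*_iy,z*_jw]=[x,y]*_k[z,w]$; and $\alpha(x*_iy)=\alpha x*_i\alpha y$. The *exterior product* $\mathfrak g\wedge\mathfrak g$ is the quotient of $\mathfrak g*\mathfrak g$ by the ideal spanned by the elements $x*_1y-x*_2y$; the common image of $x*_1y$ and $x*_2y$ is $x\wedge y$. Let $\lambda_{\mathfrak g}:\mathfrak g*\mathfrak g\to\mathfrak g$, $x*_iy\mapsto[x,y]$, and $JL_2^\alpha(\mathfrak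 g)=\ker\lambda_{\mathfrak g}$. Let $HL_2^\alpha(\mathfrak g)=\ker d_2/\operatorname{im}d_3$, where $d_2:\mathfrak g^{\otimes2}\to\mathfrak g$, $d_2(x\otimes y)=[x,y]$, and $d_3:\mathfrak g^{\otimes3}\to\mathfrak g^{\otimes2}$, $d_3(x\otimes y\otimes z)=-[x,y]\otimes\alpha z+\alpha x\otimes[y,z]+[x,z]\otimes\alpha y$. The *tensor center* is $Z^*_\alpha(\mathfrak g)=\{x:\alpha^k(x)*_iy=y*_i\alpha^k(x)=0\ \forall y\in\mathfrak g,\ k\ge0,\ i\in\{1,2\}\}$, and the *exterior center* is $Z^\wedge_\alpha(\mathfrak g)=\{x:\alpha^k(x)\wedge y=y\wedge\alpha^k(x)=0\ \forall y\in\mathfrak g,\ k\ge0\}$. **Proposition 5.4.** Let $(\mathfrak g,\alpha)$ be a Hom-Leibniz algebra over $\mathbb K$. (i) $Z^*_\alpha(\mathfrak g)$ and $Z^\wedge_\alpha(\mathfrak g)$ are central ideals of $\mathfrak g$. (ii) If $\alpha$ is surjective, then $Z^*_\alpha(\mathfrak g)\subseteq[\mathfrak g,\mathfrak g]$ and $Z^\wedge_\alpha(\mathfrak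 g)\subseteq[\mathfrak g,\mathfrak g]$. (iii) If $\pi:F\to\mathfrak g$ is a free presentation with kernel $R$, and $\bar\pi:F/[R,F]\to\mathfrak g$ is induced by $\pi$, then $Z^\wedge_\alpha(\mathfrak g)=\bar\pi\big(Z_\alpha(F/[R,F])\big)$. (iv) $Z^\wedge_\alpha(\mathfrak g)$ is the smallest central subalgebra of $\mathfrak g$ that contains every central subalgebra $\mathfrak n$ for which the canonical map $HL_2^\alpha(\mathfrak g)\to HL_2^\alpha(\mathfrak g/\mathfrak n)$ is injective. Moreover, for every central subalgebra $\mathfrak n$, this map is injective if and only if the canonical homomorphism $\mathfrak g\wedge\mathfrak g\to\mathfrak g/\mathfrak n\wedge\mathfrak g/\mathfrak n$ is an isomorphism. (v) $Z^*_\alpha(\mathfrak g)$ is the smallest central subalgebra of $\mathfrak g$ that contains every central subalgebra $\mathfrak n$ for which the canonical map $JL_2^\alpha(\mathfrak g)\to JL_2^\alpha(\mathfrak g/\mathfrak n)$ is injective. Moreover, for every central subalgebra $\mathfrak n$, this map is injective if and only if the canonical homomorphism $\mathfrak g*\mathfrak g\to\mathfrak g/\mathfrak n*\mathfrak g/\mathfrak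 n$ is an isomorphism. -/

import Mathlib

open scoped TensorProduct

universe u v w w'

/-- A (multiplicative) Hom-Leibniz algebra over the field `K`: a vector space with a bilinear
product `br K x y = [x, y]` and a linear self-map `al K`, which preserves the product, such that
`[α x, [y, z]] = [[x, y], α z] - [[x, z], α y]`. -/
class HomLeibniz (K : Type u) (g : Type v) [Field K] [AddCommGroup g] [Module K g] where
  br (K) : g →ₗ[K] g →ₗ[K] g
  al (K) : g →ₗ[K] g
  al_br : ∀ x y : g, al (br x y) = br (al x) (al y)
  leibniz : ∀ x y z : g,
    br (al x) (br y z) = br (br x y) (al z) - br (br x z) (al y)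

namespace HomLeibniz

section Basic

variable (K : Type u) [Field K] {g : Type v} [AddCommGroup g] [Module K g] [HomLeibniz K g]

/-- Homomorphisms of Hom-Leibniz algebras. -/
structure Hom (g : Type v) (h : Type w) [AddCommGroup g] [Module K g] [HomLeibniz K g]
    [AddCommGroup h] [Module K h] [HomLeibniz K h] extends g →ₗ[K] h where
  map_al : ∀ x : g, toFun (al K x) = al K (toFun x)
  map_br : ∀ x y : g, toFun (br K x y) = br K (toFun x) (toFun y)

instance {g : Type v} {h : Type w} [AddCommGroup g] [Module K g] [HomLeibniz K g]
    [AddCommGroup h] [Module K h] [HomLeibniz K h] : CoeFun (Hom K g h) (fun _ => g → h) :=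
  ⟨fun f => f.toLinearMap⟩

variable {K}

/-- Hom-Leibniz subalgebras: subspaces closed under the product and under `α`. -/
structure IsSubalgebra (S : Submodule K g) : Prop where
  al_mem : ∀ x ∈ S, al K x ∈ S
  br_mem : ∀ x ∈ S, ∀ y ∈ S, br K x y ∈ S

/-- (Two-sided, `α`-invariant) ideals. -/
structure IsIdeal (S : Submodule K g) : Prop where
  al_mem : ∀ x ∈ S, al K x ∈ S
  br_mem_left : ∀ x ∈ S, ∀ y : g, br K x y ∈ S
  br_mem_right : ∀ x ∈ S, ∀ y : g, br K y x ∈ S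

variable (K g)

/-- The (two-sided) center `Z(g)`. -/
def center : Submodule K g where
  carrier := {x | ∀ y : g, br K x y = 0 ∧ br K y x = 0}
  zero_mem' := by intro y; simp
  add_mem' := by
    intro a b ha hb y
    simp [(ha y).1, (ha y).2, (hb y).1, (hb y).2]
  smul_mem' := by
    intro c a ha y
    simp [(ha y).1, (ha y).2]

/-- The `α`-center `Z_α(g)`: all `x` with `α ^ k x` in the center for every `k ≥ 0`. -/
def alphaCenter : Submodule K g where
  carrier := {x | ∀ (k : ℕ) (y : g), br K ((al K ^ k) x) y = 0 ∧ br K y ((al K ^ k) x) = 0}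
  zero_mem' := by intro k y; simp
  add_mem' := by
    intro a b ha hb k y
    simp [(ha k y).1, (ha k y).2, (hb k y).1, (hb k y).2]
  smul_mem' := by
    intro c a ha k y
    simp [(ha k y).1, (ha k y).2]

variable {K g}

/-- Central subalgebras: subalgebras contained in the center. -/
structure IsCentralSubalgebra (S : Submodule K g) : Prop extends IsSubalgebra S where
  le_center : S ≤ center K g

/-- Central ideals: ideals contained in the center. -/
structure IsCentralIdeal (S : Submodule K g) : Prop extends IsIdeal S where
  le_center : S ≤ center K g

theorem IsCentralSubalgebra.isIdeal {S : Submodule K g} (h : IsCentralSubalgebra S) :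
    IsIdeal S where
  al_mem := h.al_mem
  br_mem_left := fun x hx y => by rw [(h.le_center hx y).1]; exact S.zero_mem
  br_mem_right := fun x hx y => by rw [(h.le_center hx y).2]; exact S.zero_mem

/-- The commutator `[S, T]` of two ideals: the span of all `[s, t]` and `[t, s]`.  For ideals
`S`, `T` this span is already closed under the product and under `α`. -/
def commutator (S T : Submodule K g) : Submodule K g :=
  Submodule.span K {z | ∃ s ∈ S, ∃ t ∈ T, z = br K s t ∨ z = br K t s}

theorem commutator_top_isIdeal {S : Submodule K g} (hS : IsIdeal S) :
    IsIdeal (commutator S ⊤) := by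
  have hle : commutator S ⊤ ≤ S := by
    refine Submodule.span_le.2 ?_
    rintro z ⟨s, hs, t, -, rfl | rfl⟩
    · exact hS.br_mem_left s hs t
    · exact hS.br_mem_right s hs t
  refine ⟨fun x hx => ?_, fun x hx y => ?_, fun x hx y => ?_⟩
  · have : commutator S ⊤ ≤ (commutator S ⊤).comap (al K) := by
      refine Submodule.span_le.2 ?_
      rintro z ⟨s, hs, t, -, rfl | rfl⟩
      · exact Submodule.subset_span
          ⟨al K s, hS.al_mem s hs, al K t, trivial, Or.inl (al_br s t)⟩
      · exact Submodule.subset_span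
          ⟨al K s, hS.al_mem s hs, al K t, trivial, Or.inr (al_br t s)⟩
    exact this hx
  · exact Submodule.subset_span ⟨x, hle hx, y, trivial, Or.inl rfl⟩
  · exact Submodule.subset_span ⟨x, hle hx, y, trivial, Or.inr rfl⟩

theorem Hom.ker_isIdeal {h : Type w} [AddCommGroup h] [Module K h] [HomLeibniz K h]
    (f : Hom K g h) : IsIdeal (LinearMap.ker f.toLinearMap) where
  al_mem := fun x hx => by
    have hx' : f x = 0 := hx
    have := f.map_al x
    change f (al K x) = al K (f x) at this
    change f (al K x) = 0
    rw [this, hx', map_zero]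
  br_mem_left := fun x hx y => by
    have hx' : f x = 0 := hx
    have := f.map_br x y
    change f (br K x y) = br K (f x) (f y) at this
    change f (br K x y) = 0
    rw [this, hx', map_zero, LinearMap.zero_apply]
  br_mem_right := fun x hx y => by
    have hx' : f x = 0 := hx
    have := f.map_br y x
    change f (br K y x) = br K (f y) (f x) at this
    change f (br K y x) = 0
    rw [this, hx', map_zero]

end Basic

section Quotient

variable {K : Type u} [Field K] {g : Type v} [AddCommGroup g] [Module K g] [HomLeibniz K g]
variable {h : Type w} [AddCommGroup h] [Module K h] [HomLeibniz K h]

/-- The quotient Hom-Leibniz algebra `g / S` by an ideal `S`. -/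
def Quo (S : Submodule K g) (_hS : IsIdeal S) : Type v := g ⧸ S

instance (S : Submodule K g) (hS : IsIdeal S) : AddCommGroup (Quo S hS) :=
  inferInstanceAs (AddCommGroup (g ⧸ S))

instance (S : Submodule K g) (hS : IsIdeal S) : Module K (Quo S hS) :=
  inferInstanceAs (Module K (g ⧸ S))

/-- The bilinear product induced on `g / S`. -/
def quoBr (S : Submodule K g) (hS : IsIdeal S) : (g ⧸ S) →ₗ[K] (g ⧸ S) →ₗ[K] (g ⧸ S) :=
  S.liftQ
    { toFun := fun x => S.mapQ S (br K x) (fun y hy => hS.br_mem_right y hy x)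
      map_add' := fun x y => by
        refine LinearMap.ext fun z => ?_
        obtain ⟨z, rfl⟩ := S.mkQ_surjective z
        simp
      map_smul' := fun c x => by
        refine LinearMap.ext fun z => ?_
        obtain ⟨z, rfl⟩ := S.mkQ_surjective z
        simp }
    (fun x hx => by
      refine LinearMap.ext fun z => ?_
      obtain ⟨z, rfl⟩ := S.mkQ_surjective z
      simpa using hS.br_mem_left x hx z)

instance (S : Submodule K g) (hS : IsIdeal S) : HomLeibniz K (Quo S hS) where
  br := quoBr S hS
  al := S.mapQ S (al K) (fun x hx => hS.al_mem x hx)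
  al_br := fun x y => by
    obtain ⟨x, rfl⟩ := S.mkQ_surjective x
    obtain ⟨y, rfl⟩ := S.mkQ_surjective y
    exact congrArg S.mkQ (al_br x y)
  leibniz := fun x y z => by
    obtain ⟨x, rfl⟩ := S.mkQ_surjective x
    obtain ⟨y, rfl⟩ := S.mkQ_surjective y
    obtain ⟨z, rfl⟩ := S.mkQ_surjective z
    exact congrArg S.mkQ (leibniz x y z)

/-- The canonical projection `g → g / S`. -/
def Quo.mk (S : Submodule K g) (hS : IsIdeal S) : Hom K g (Quo S hS) where
  toLinearMap := S.mkQ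
  map_al := fun _ => rfl
  map_br := fun _ _ => rfl

/-- The homomorphism `g / S → h` induced by a homomorphism `g → h` that vanishes on `S`. -/
def Quo.lift (S : Submodule K g) (hS : IsIdeal S) (f : Hom K g h)
    (hf : S ≤ LinearMap.ker f.toLinearMap) : Hom K (Quo S hS) h where
  toLinearMap := S.liftQ f.toLinearMap hf
  map_al := fun x => by
    obtain ⟨x, rfl⟩ := S.mkQ_surjective x
    exact f.map_al x
  map_br := fun x y => by
    obtain ⟨x, rfl⟩ := S.mkQ_surjective x
    obtain ⟨y, rfl⟩ := S.mkQ_surjective y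
    exact f.map_br x y

/-- Composition of homomorphisms. -/
def Hom.comp {k : Type w'} [AddCommGroup k] [Module K k] [HomLeibniz K k]
    (f : Hom K h k) (e : Hom K g h) : Hom K g k where
  toLinearMap := f.toLinearMap.comp e.toLinearMap
  map_al := fun x => (congrArg f (e.map_al x)).trans (f.map_al (e x))
  map_br := fun x y => (congrArg f (e.map_br x y)).trans (f.map_br (e x) (e y))

end Quotient

section Presentation

/-- Formal expressions in the operations of a Hom-Leibniz algebra, on a set `X` of generators. -/
inductive Term (K : Type u) (X : Type v) : Type (max u v)
  | gen : X → Term K X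
  | zero : Term K X
  | add : Term K X → Term K X → Term K X
  | smul : K → Term K X → Term K X
  | br : Term K X → Term K X → Term K X
  | al : Term K X → Term K X

/-- The congruence on expressions generated by the axioms of a Hom-Leibniz algebra and by the
relations `r`. -/
inductive Cong {K : Type u} [Field K] {X : Type v} (r : Term K X → Term K X → Prop) :
    Term K X → Term K X → Prop
  | of {a b} : r a b → Cong r a b
  | refl (a) : Cong r a a
  | symm {a b} : Cong r a b → Cong r b a
  | trans {a b c} : Cong r a b → Cong r b c → Cong r a c
  | add {a a' b b'} : Cong r a a' → Cong r b b' → Cong r (.add a b) (.add a' b')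
  | smul (c : K) {a a'} : Cong r a a' → Cong r (.smul c a) (.smul c a')
  | br {a a' b b'} : Cong r a a' → Cong r b b' → Cong r (.br a b) (.br a' b')
  | al {a a'} : Cong r a a' → Cong r (.al a) (.al a')
  | add_assoc (a b c) : Cong r (.add (.add a b) c) (.add a (.add b c))
  | add_comm (a b) : Cong r (.add a b) (.add b a)
  | zero_add (a) : Cong r (.add .zero a) a
  | one_smul (a) : Cong r (.smul 1 a) a
  | zero_smul (a) : Cong r (.smul 0 a) .zero
  | mul_smul (c d : K) (a) : Cong r (.smul (c * d) a) (.smul c (.smul d a))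
  | add_smul (c d : K) (a) : Cong r (.smul (c + d) a) (.add (.smul c a) (.smul d a))
  | smul_add (c : K) (a b) : Cong r (.smul c (.add a b)) (.add (.smul c a) (.smul c b))
  | br_add_left (a b c) : Cong r (.br (.add a b) c) (.add (.br a c) (.br b c))
  | br_smul_left (k : K) (a b) : Cong r (.br (.smul k a) b) (.smul k (.br a b))
  | br_add_right (a b c) : Cong r (.br a (.add b c)) (.add (.br a b) (.br a c))
  | br_smul_right (k : K) (a b) : Cong r (.br a (.smul k b)) (.smul k (.br a b))
  | al_add (a b) : Cong r (.al (.add a b)) (.add (.al a) (.al b))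
  | al_smul (k : K) (a) : Cong r (.al (.smul k a)) (.smul k (.al a))
  | al_br (a b) : Cong r (.al (.br a b)) (.br (.al a) (.al b))
  | leibniz (a b c) : Cong r (.br (.al a) (.br b c))
      (.add (.br (.br a b) (.al c)) (.smul (-1) (.br (.br a c) (.al b))))

variable {K : Type u} [Field K] {X : Type v}

/-- The Hom-Leibniz algebra generated by `X` subject to the relations `r`. -/
def Presented (r : Term K X → Term K X → Prop) : Type (max u v) := Quot (Cong r)

namespace Presented

variable (r : Term K X → Term K X → Prop)

/-- The class of an expression. -/
def mk (a : Term K X) : Presented r := Quot.mk _ a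

instance : Zero (Presented r) := ⟨mk r .zero⟩

instance : Add (Presented r) :=
  ⟨Quot.map₂ Term.add (fun a _ _ h => Cong.add (.refl a) h) (fun _ _ b h => Cong.add h (.refl b))⟩

instance : SMul K (Presented r) :=
  ⟨fun c => Quot.map (Term.smul c) (fun _ _ h => Cong.smul c h)⟩

instance : Neg (Presented r) := ⟨fun x => (-1 : K) • x⟩

/-- The product on the presented algebra, as a function. -/
def brFun : Presented r → Presented r → Presented r :=
  Quot.map₂ Term.br (fun a _ _ h => Cong.br (.refl a) h) (fun _ _ b h => Cong.br h (.refl b))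

/-- The self-map of the presented algebra, as a function. -/
def alFun : Presented r → Presented r := Quot.map Term.al (fun _ _ h => Cong.al h)

instance : AddCommGroup (Presented r) where
  add_assoc := by
    rintro ⟨a⟩ ⟨b⟩ ⟨c⟩
    exact Quot.sound (.add_assoc a b c)
  zero_add := by
    rintro ⟨a⟩
    exact Quot.sound (.zero_add a)
  add_zero := by
    rintro ⟨a⟩
    exact Quot.sound ((Cong.add_comm a .zero).trans (.zero_add a))
  add_comm := by
    rintro ⟨a⟩ ⟨b⟩
    exact Quot.sound (.add_comm a b)
  nsmul := nsmulRec
  zsmul := zsmulRec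
  neg_add_cancel := by
    rintro ⟨a⟩
    refine Quot.sound ?_
    refine (Cong.add (.refl _) (Cong.one_smul a).symm).trans ?_
    refine (Cong.add_smul (-1) 1 a).symm.trans ?_
    rw [neg_add_cancel]
    exact .zero_smul a

instance : Module K (Presented r) where
  one_smul := by
    rintro ⟨a⟩
    exact Quot.sound (.one_smul a)
  mul_smul := by
    rintro c d ⟨a⟩
    exact Quot.sound (.mul_smul c d a)
  smul_zero := by
    intro c
    refine Quot.sound ?_
    refine (Cong.smul c (Cong.zero_smul .zero).symm).trans ?_
    refine (Cong.mul_smul c 0 .zero).symm.trans ?_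
    rw [mul_zero]
    exact .zero_smul _
  smul_add := by
    rintro c ⟨a⟩ ⟨b⟩
    exact Quot.sound (.smul_add c a b)
  add_smul := by
    rintro c d ⟨a⟩
    exact Quot.sound (.add_smul c d a)
  zero_smul := by
    rintro ⟨a⟩
    exact Quot.sound (.zero_smul a)

instance : HomLeibniz K (Presented r) where
  br := LinearMap.mk₂ K (brFun r)
    (by
      rintro ⟨a⟩ ⟨b⟩ ⟨c⟩
      exact Quot.sound (.br_add_left a b c))
    (by
      rintro k ⟨a⟩ ⟨b⟩
      exact Quot.sound (.br_smul_left k a b))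
    (by
      rintro ⟨a⟩ ⟨b⟩ ⟨c⟩
      exact Quot.sound (.br_add_right a b c))
    (by
      rintro k ⟨a⟩ ⟨b⟩
      exact Quot.sound (.br_smul_right k a b))
  al :=
    { toFun := alFun r
      map_add' := by
        rintro ⟨a⟩ ⟨b⟩
        exact Quot.sound (.al_add a b)
      map_smul' := by
        rintro k ⟨a⟩
        exact Quot.sound (.al_smul k a) }
  al_br := by
    rintro ⟨a⟩ ⟨b⟩
    exact Quot.sound (.al_br a b)
  leibniz := by
    rintro ⟨a⟩ ⟨b⟩ ⟨c⟩
    rw [sub_eq_add_neg]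
    exact Quot.sound (.leibniz a b c)

variable {r}
variable {L : Type w} [AddCommGroup L] [Module K L] [HomLeibniz K L]

/-- The value of an expression in a Hom-Leibniz algebra. -/
def _root_.HomLeibniz.Term.eval (f : X → L) : Term K X → L
  | .gen x => f x
  | .zero => 0
  | .add a b => a.eval f + b.eval f
  | .smul c a => c • a.eval f
  | .br a b => HomLeibniz.br K (a.eval f) (b.eval f)
  | .al a => HomLeibniz.al K (a.eval f)

theorem eval_eq (f : X → L) (hf : ∀ a b, r a b → a.eval f = b.eval f) {a b : Term K X}
    (h : Cong r a b) : a.eval f = b.eval f := by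
  induction h with
  | of h => exact hf _ _ h
  | refl => rfl
  | symm _ ih => exact ih.symm
  | trans _ _ ih ih' => exact ih.trans ih'
  | add _ _ ih ih' => simp only [Term.eval, ih, ih']
  | smul _ _ ih => simp only [Term.eval, ih]
  | br _ _ ih ih' => simp only [Term.eval, ih, ih']
  | al _ ih => simp only [Term.eval, ih]
  | add_assoc => simp only [Term.eval, _root_.add_assoc]
  | add_comm => simp only [Term.eval]; exact _root_.add_comm _ _
  | zero_add => simp [Term.eval]
  | one_smul => simp [Term.eval]
  | zero_smul => simp [Term.eval]
  | mul_smul => simp [Term.eval, SemigroupAction.mul_smul]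
  | add_smul => simp [Term.eval, _root_.add_smul]
  | smul_add => simp [Term.eval]
  | br_add_left => simp [Term.eval]
  | br_smul_left => simp [Term.eval]
  | br_add_right => simp [Term.eval]
  | br_smul_right => simp [Term.eval]
  | al_add => simp [Term.eval]
  | al_smul => simp [Term.eval]
  | al_br => simp only [Term.eval]; exact HomLeibniz.al_br _ _
  | leibniz a b c =>
    simp only [Term.eval, HomLeibniz.leibniz (K := K), neg_smul, _root_.one_smul, sub_eq_add_neg]

/-- The homomorphism out of a presented algebra given by images of the generators that satisfy
the relations. -/
def lift (f : X → L) (hf : ∀ a b, r a b → a.eval f = b.eval f) : Hom K (Presented r) L where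
  toFun := Quot.lift (Term.eval f) (fun _ _ h => eval_eq f hf h)
  map_add' := by
    rintro ⟨a⟩ ⟨b⟩
    rfl
  map_smul' := by
    rintro c ⟨a⟩
    rfl
  map_al := by
    rintro ⟨a⟩
    rfl
  map_br := by
    rintro ⟨a⟩ ⟨b⟩
    rfl

end Presented

end Presentation

section Free

variable (K : Type u) [Field K]

/-- The relations making the insertion of generators of a Hom-vector space `(V, αV)` linear and
compatible with the self-maps. -/
inductive FreeRel {V : Type w} [AddCommGroup V] [Module K V] (aV : V →ₗ[K] V) :
    Term K V → Term K V → Prop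
  | add (x y : V) : FreeRel aV (.gen (x + y)) (.add (.gen x) (.gen y))
  | smul (c : K) (x : V) : FreeRel aV (.gen (c • x)) (.smul c (.gen x))
  | al (x : V) : FreeRel aV (.gen (aV x)) (.al (.gen x))

/-- The free Hom-Leibniz algebra over the Hom-vector space `(V, αV)`. -/
abbrev FreeHomLeibniz {V : Type w} [AddCommGroup V] [Module K V] (aV : V →ₗ[K] V) :
    Type (max u w) :=
  Presented (FreeRel K aV)

/-- `F` is a free Hom-Leibniz algebra: it is isomorphic to the free Hom-Leibniz algebra over some
Hom-vector space. -/
def IsFree (F : Type v) [AddCommGroup F] [Module K F] [HomLeibniz K F] : Prop :=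
  ∃ (V : Type w) (_ : AddCommGroup V) (_ : Module K V) (aV : V →ₗ[K] V)
    (e : Hom K (FreeHomLeibniz K aV) F), Function.Bijective e

end Free

section Central

variable {K : Type u} [Field K] {F : Type w} [AddCommGroup F] [Module K F] [HomLeibniz K F]
variable {g : Type v} [AddCommGroup g] [Module K g] [HomLeibniz K g]

/-- For a homomorphism `π : F → g` with kernel `R`, the quotient `F / [R, F]`. -/
abbrev CentralQuo (π : Hom K F g) : Type w :=
  Quo (commutator (LinearMap.ker π.toLinearMap) ⊤) (commutator_top_isIdeal π.ker_isIdeal)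

theorem commutator_le_ker (π : Hom K F g) :
    commutator (LinearMap.ker π.toLinearMap) ⊤ ≤ LinearMap.ker π.toLinearMap := by
  refine Submodule.span_le.2 ?_
  rintro z ⟨s, hs, t, -, rfl | rfl⟩
  · exact π.ker_isIdeal.br_mem_left s hs t
  · exact π.ker_isIdeal.br_mem_right s hs t

/-- The homomorphism `F / [R, F] → g` induced by `π`. -/
def piBar (π : Hom K F g) : Hom K (CentralQuo π) g :=
  Quo.lift _ _ π (commutator_le_ker π)

end Central

section Tensor

variable (K : Type u) [Field K] (g : Type v) [AddCommGroup g] [Module K g] [HomLeibniz K g]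

/-- The generators of the tensor product `M * N` for `M = N = g`: the symbols `m * n`, written
`mn m n`, and the symbols `n * m`, written `nm n m`, where `m ∈ M` and `n ∈ N`.  These are two
different families of symbols. -/
inductive TensorGen (g : Type v) : Type v
  | mn : g → g → TensorGen g
  | nm : g → g → TensorGen g

/-- The map on generators with values `a m n` at `m * n` and `b n m` at `n * m`. -/
def TensorGen.elim {g : Type v} {L : Type w} (a b : g → g → L) : TensorGen g → L
  | .mn m n => a m n
  | .nm n m => b n m

variable {g} in
/-- The expression `m * n` with `m` from the first factor and `n` from the second. -/
abbrev Term.mn (m n : g) : Term K (TensorGen g) := .gen (.mn m n)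

variable {g} in
/-- The expression `n * m` with `n` from the second factor and `m` from the first. -/
abbrev Term.nm (n m : g) : Term K (TensorGen g) := .gen (.nm n m)

open Term in
/-- The defining relations of the tensor product `M * N` of crossed modules `M → g`, `N → g`, in
the case where both crossed modules are the identity of `g`, so that every action is given by the
product: `ᵐn = [m, n] = mⁿ` and `ⁿm = [n, m] = nᵐ`.  The letters `m`, `m'` stand for elements of
the first factor and `n`, `n'` for elements of the second factor. -/
inductive TensorRel : Term K (TensorGen g) → Term K (TensorGen g) → Prop
  | r1a (k : K) (m n : g) : TensorRel (.smul k (mn K m n)) (mn K (k • m) n)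
  | r1a' (k : K) (m n : g) : TensorRel (.smul k (mn K m n)) (mn K m (k • n))
  | r1b (k : K) (m n : g) : TensorRel (.smul k (nm K n m)) (nm K (k • n) m)
  | r1b' (k : K) (m n : g) : TensorRel (.smul k (nm K n m)) (nm K n (k • m))
  | r2a (m m' n : g) : TensorRel (mn K (m + m') n) (.add (mn K m n) (mn K m' n))
  | r2b (m n n' : g) : TensorRel (nm K (n + n') m) (.add (nm K n m) (nm K n' m))
  | r2c (m n n' : g) : TensorRel (mn K m (n + n')) (.add (mn K m n) (mn K m n'))
  | r2d (m m' n : g) : TensorRel (nm K n (m + m')) (.add (nm K n m) (nm K n m'))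
  | r3a (m m' n : g) :
      TensorRel (mn K (al K m) (br K m' n)) (.smul (-1) (mn K (al K m) (br K n m')))
  | r3b (m n n' : g) :
      TensorRel (nm K (al K n) (br K n' m)) (.smul (-1) (nm K (al K n) (br K m n')))
  | r4a (m n n' : g) : TensorRel (mn K (al K m) (br K n n'))
      (.add (mn K (br K m n) (al K n')) (.smul (-1) (mn K (br K m n') (al K n))))
  | r4b (m m' n : g) : TensorRel (nm K (al K n) (br K m m'))
      (.add (nm K (br K n m) (al K m')) (.smul (-1) (nm K (br K n m') (al K m))))
  | r4c (m m' n : g) : TensorRel (mn K (br K m m') (al K n))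
      (.add (nm K (br K m n) (al K m')) (.smul (-1) (mn K (al K m) (br K n m'))))
  | r4d (m n n' : g) : TensorRel (nm K (br K n n') (al K m))
      (.add (mn K (br K n m) (al K n')) (.smul (-1) (nm K (al K n) (br K m n'))))
  | r5a (m n m' n' : g) :
      TensorRel (mn K (br K m n) (br K m' n')) (.br (mn K m n) (mn K m' n'))
  | r5a' (m n m' n' : g) :
      TensorRel (.br (mn K m n) (mn K m' n')) (nm K (br K m n) (br K m' n'))
  | r5b (m n m' n' : g) :
      TensorRel (mn K (br K n m) (br K n' m')) (.br (nm K n m) (nm K n' m'))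
  | r5b' (m n m' n' : g) :
      TensorRel (.br (nm K n m) (nm K n' m')) (nm K (br K n m) (br K n' m'))
  | r5c (m n m' n' : g) :
      TensorRel (mn K (br K m n) (br K n' m')) (.br (mn K m n) (nm K n' m'))
  | r5c' (m n m' n' : g) :
      TensorRel (.br (mn K m n) (nm K n' m')) (nm K (br K m n) (br K n' m'))
  | r5d (m n m' n' : g) :
      TensorRel (mn K (br K n m) (br K m' n')) (.br (nm K n m) (mn K m' n'))
  | r5d' (m n m' n' : g) :
      TensorRel (.br (nm K n m) (mn K m' n')) (nm K (br K n m) (br K m' n'))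
  | al_mn (m n : g) : TensorRel (.al (mn K m n)) (mn K (al K m) (al K n))
  | al_nm (m n : g) : TensorRel (.al (nm K n m)) (nm K (al K n) (al K m))

/-- The Hom-Leibniz tensor product `g * g`. -/
abbrev TensorSq : Type (max u v) := Presented (TensorRel K g)

variable {g}

/-- The element `m * n` of `g * g`, where `m` is taken from the first factor. -/
def tmn (m n : g) : TensorSq K g := Presented.mk _ (Term.mn K m n)

/-- The element `n * m` of `g * g`, where `n` is taken from the second factor. -/
def tnm (n m : g) : TensorSq K g := Presented.mk _ (Term.nm K n m)

theorem tmn_add_left (m m' n : g) : tmn K (m + m') n = tmn K m n + tmn K m' n :=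
  Quot.sound (.of (.r2a m m' n))
theorem tmn_add_right (m n n' : g) : tmn K m (n + n') = tmn K m n + tmn K m n' :=
  Quot.sound (.of (.r2c m n n'))
theorem tnm_add_left (n n' m : g) : tnm K (n + n') m = tnm K n m + tnm K n' m :=
  Quot.sound (.of (.r2b m n n'))
theorem tnm_add_right (n m m' : g) : tnm K n (m + m') = tnm K n m + tnm K n m' :=
  Quot.sound (.of (.r2d m m' n))
theorem tmn_smul_left (k : K) (m n : g) : tmn K (k • m) n = k • tmn K m n :=
  (Quot.sound (.of (.r1a k m n)) : k • tmn K m n = _).symm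
theorem tmn_smul_right (k : K) (m n : g) : tmn K m (k • n) = k • tmn K m n :=
  (Quot.sound (.of (.r1a' k m n)) : k • tmn K m n = _).symm
theorem tnm_smul_left (k : K) (n m : g) : tnm K (k • n) m = k • tnm K n m :=
  (Quot.sound (.of (.r1b k m n)) : k • tnm K n m = _).symm
theorem tnm_smul_right (k : K) (n m : g) : tnm K n (k • m) = k • tnm K n m :=
  (Quot.sound (.of (.r1b' k m n)) : k • tnm K n m = _).symm

theorem al_tmn (m n : g) : al K (tmn K m n) = tmn K (al K m) (al K n) :=
  Quot.sound (.of (.al_mn m n))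
theorem al_tnm (n m : g) : al K (tnm K n m) = tnm K (al K n) (al K m) :=
  Quot.sound (.of (.al_nm m n))

theorem br_tmn_tmn (x y x' y' : g) :
    br K (tmn K x y) (tmn K x' y') = tmn K (br K x y) (br K x' y') :=
  (Quot.sound (.of (.r5a x y x' y')) : tmn K (br K x y) (br K x' y') = _).symm
theorem br_tnm_tnm (x y x' y' : g) :
    br K (tnm K x y) (tnm K x' y') = tmn K (br K x y) (br K x' y') :=
  (Quot.sound (.of (.r5b y x y' x')) : tmn K (br K x y) (br K x' y') = _).symm
theorem br_tmn_tnm (x y x' y' : g) :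
    br K (tmn K x y) (tnm K x' y') = tmn K (br K x y) (br K x' y') :=
  (Quot.sound (.of (.r5c x y y' x')) : tmn K (br K x y) (br K x' y') = _).symm
theorem br_tnm_tmn (x y x' y' : g) :
    br K (tnm K x y) (tmn K x' y') = tmn K (br K x y) (br K x' y') :=
  (Quot.sound (.of (.r5d y x x' y')) : tmn K (br K x y) (br K x' y') = _).symm

/-- `(x, y) ↦ x * y`, with `x` taken from the first factor, as a bilinear map. -/
def tmnB : g →ₗ[K] g →ₗ[K] TensorSq K g :=
  LinearMap.mk₂ K (tmn K) (tmn_add_left K) (tmn_smul_left K) (tmn_add_right K) (tmn_smul_right K)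

/-- `(x, y) ↦ x * y`, with `x` taken from the second factor, as a bilinear map. -/
def tnmB : g →ₗ[K] g →ₗ[K] TensorSq K g :=
  LinearMap.mk₂ K (tnm K) (tnm_add_left K) (tnm_smul_left K) (tnm_add_right K) (tnm_smul_right K)

variable (g)

/-- The commutator map `λ : g * g → g`, `x * y ↦ [x, y]`. -/
def lam : Hom K (TensorSq K g) g :=
  Presented.lift (TensorGen.elim (fun m n => br K m n) (fun n m => br K n m)) (by
    intro a b h
    cases h <;> simp only [Term.eval, TensorGen.elim, map_smul, LinearMap.smul_apply, map_add,
      LinearMap.add_apply, al_br, leibniz, neg_smul, one_smul, neg_sub] <;> abel)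

/-- `JL₂(g)`, the kernel of `λ : g * g → g`. -/
abbrev JL2 : Submodule K (TensorSq K g) := LinearMap.ker (lam K g).toLinearMap

variable {g} {h : Type w} [AddCommGroup h] [Module K h] [HomLeibniz K h]

variable {K}

/-- The homomorphism `g * g → h * h` induced by `f : g → h`. -/
def tensorMap (f : Hom K g h) : Hom K (TensorSq K g) (TensorSq K h) :=
  Presented.lift
    (TensorGen.elim (fun m n => tmn K (f m) (f n)) (fun n m => tnm K (f n) (f m))) (by
    have hb : ∀ x y, f (br K x y) = br K (f x) (f y) := f.map_br
    have ha : ∀ x, f (al K x) = al K (f x) := f.map_al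
    intro a b h
    cases h <;> simp only [Term.eval, TensorGen.elim, map_smul, map_add, hb, ha]
    · exact Quot.sound (.of (.r1a _ _ _))
    · exact Quot.sound (.of (.r1a' _ _ _))
    · exact Quot.sound (.of (.r1b _ _ _))
    · exact Quot.sound (.of (.r1b' _ _ _))
    · exact Quot.sound (.of (.r2a _ _ _))
    · exact Quot.sound (.of (.r2b _ _ _))
    · exact Quot.sound (.of (.r2c _ _ _))
    · exact Quot.sound (.of (.r2d _ _ _))
    · exact Quot.sound (.of (.r3a _ _ _))
    · exact Quot.sound (.of (.r3b _ _ _))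
    · exact Quot.sound (.of (.r4a _ _ _))
    · exact Quot.sound (.of (.r4b _ _ _))
    · exact Quot.sound (.of (.r4c _ _ _))
    · exact Quot.sound (.of (.r4d _ _ _))
    · exact Quot.sound (.of (.r5a _ _ _ _))
    · exact Quot.sound (.of (.r5a' _ _ _ _))
    · exact Quot.sound (.of (.r5b _ _ _ _))
    · exact Quot.sound (.of (.r5b' _ _ _ _))
    · exact Quot.sound (.of (.r5c _ _ _ _))
    · exact Quot.sound (.of (.r5c' _ _ _ _))
    · exact Quot.sound (.of (.r5d _ _ _ _))
    · exact Quot.sound (.of (.r5d' _ _ _ _))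
    · exact Quot.sound (.of (.al_mn _ _))
    · exact Quot.sound (.of (.al_nm _ _)))

@[simp] theorem lam_tmn (x y : g) : lam K g (tmn K x y) = br K x y := rfl
@[simp] theorem lam_tnm (x y : g) : lam K g (tnm K x y) = br K x y := rfl
@[simp] theorem tensorMap_tmn (f : Hom K g h) (x y : g) :
    tensorMap f (tmn K x y) = tmn K (f x) (f y) := rfl
@[simp] theorem tensorMap_tnm (f : Hom K g h) (x y : g) :
    tensorMap f (tnm K x y) = tnm K (f x) (f y) := rfl

variable (K g) in
/-- The elements `x * y` of both kinds span `g * g` as a vector space. -/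
theorem span_tensor :
    Submodule.span K (Set.range (fun p : g × g => tmn K p.1 p.2) ∪
      Set.range (fun p : g × g => tnm K p.1 p.2)) = ⊤ := by
  set S := Submodule.span K (Set.range (fun p : g × g => tmn K p.1 p.2) ∪
      Set.range (fun p : g × g => tnm K p.1 p.2)) with hS
  have hmn : ∀ x y : g, tmn K x y ∈ S := fun x y => Submodule.subset_span (Or.inl ⟨(x, y), rfl⟩)
  have hnm : ∀ x y : g, tnm K x y ∈ S := fun x y => Submodule.subset_span (Or.inr ⟨(x, y), rfl⟩)
  have hal : ∀ z ∈ S, al K z ∈ S := by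
    have : S ≤ S.comap (al K) := by
      refine Submodule.span_le.2 ?_
      rintro _ (⟨⟨x, y⟩, rfl⟩ | ⟨⟨x, y⟩, rfl⟩)
      · change al K (tmn K x y) ∈ S
        rw [al_tmn]
        exact hmn _ _
      · change al K (tnm K x y) ∈ S
        rw [al_tnm]
        exact hnm _ _
    exact this
  have hbr : ∀ z ∈ S, ∀ z' ∈ S, br K z z' ∈ S := by
    intro z hz z' hz'
    refine Submodule.span_induction₂ (p := fun z z' _ _ => br K z z' ∈ S) ?_ ?_ ?_ ?_ ?_ ?_ ?_
      hz hz'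
    · rintro _ _ (⟨⟨x, y⟩, rfl⟩ | ⟨⟨x, y⟩, rfl⟩) (⟨⟨x', y'⟩, rfl⟩ | ⟨⟨x', y'⟩, rfl⟩)
      · change br K (tmn K x y) (tmn K x' y') ∈ S
        rw [br_tmn_tmn]
        exact hmn _ _
      · change br K (tmn K x y) (tnm K x' y') ∈ S
        rw [br_tmn_tnm]
        exact hmn _ _
      · change br K (tnm K x y) (tmn K x' y') ∈ S
        rw [br_tnm_tmn]
        exact hmn _ _
      · change br K (tnm K x y) (tnm K x' y') ∈ S
        rw [br_tnm_tnm]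
        exact hmn _ _
    · intro y _
      simp
    · intro y _
      simp
    · intro x y z _ _ _ h1 h2
      simpa using S.add_mem h1 h2
    · intro x y z _ _ _ h1 h2
      simpa using S.add_mem h1 h2
    · intro c x y _ _ h1
      simpa using S.smul_mem c h1
    · intro c x y _ _ h1
      simpa using S.smul_mem c h1
  rw [eq_top_iff]
  rintro ⟨a⟩ -
  change Presented.mk _ a ∈ S
  induction a with
  | gen x =>
    cases x with
    | mn m n => exact hmn m n
    | nm n m => exact hnm n m
  | zero => exact S.zero_mem
  | add a b ha hb => exact S.add_mem ha hb
  | smul c a ha => exact S.smul_mem c ha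
  | br a b ha hb => exact hbr _ ha _ hb
  | al a ha => exact hal _ ha

variable (K g)

/-- `g □ g`, the subspace of `g * g` spanned by the elements `m * n' - n * m'` with `m = n` in `g`
and `m' = n'` in `g`. -/
def box : Submodule K (TensorSq K g) :=
  Submodule.span K {z | ∃ x y : g, z = tmn K x y - tnm K x y}

theorem box_isIdeal : IsIdeal (box K g) := by
  have key : ∀ z ∈ box K g, ∀ w : TensorSq K g, br K z w = 0 ∧ br K w z = 0 := by
    intro z hz w
    have hw : w ∈ Submodule.span K (Set.range (fun p : g × g => tmn K p.1 p.2) ∪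
        Set.range (fun p : g × g => tnm K p.1 p.2)) := by
      rw [span_tensor]
      trivial
    refine Submodule.span_induction₂ (p := fun z w _ _ => br K z w = 0 ∧ br K w z = 0)
      ?_ ?_ ?_ ?_ ?_ ?_ ?_ hz hw
    · rintro _ _ ⟨x, y, rfl⟩ (⟨⟨x', y'⟩, rfl⟩ | ⟨⟨x', y'⟩, rfl⟩)
      · simp [br_tmn_tmn, br_tnm_tmn, br_tmn_tnm]
      · simp [br_tnm_tnm, br_tnm_tmn, br_tmn_tnm]
    · intro y _
      simp
    · intro y _
      simp
    · intro x y z _ _ _ h1 h2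
      simp [h1.1, h1.2, h2.1, h2.2]
    · intro x y z _ _ _ h1 h2
      simp [h1.1, h1.2, h2.1, h2.2]
    · intro c x y _ _ h1
      simp [h1.1, h1.2]
    · intro c x y _ _ h1
      simp [h1.1, h1.2]
  refine ⟨fun z hz => ?_, fun z hz w => ?_, fun z hz w => ?_⟩
  · have : box K g ≤ (box K g).comap (al K) := by
      refine Submodule.span_le.2 ?_
      rintro _ ⟨x, y, rfl⟩
      refine Submodule.subset_span ⟨al K x, al K y, ?_⟩
      rw [map_sub, al_tmn, al_tnm]
    exact this hz
  · rw [(key z hz w).1]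
    exact Submodule.zero_mem _
  · rw [(key z hz w).2]
    exact Submodule.zero_mem _

/-- The exterior product `g ∧ g = (g * g) / (g □ g)`. -/
abbrev ExtSq : Type (max u v) := Quo (box K g) (box_isIdeal K g)

variable {g}

/-- The element `x ∧ y` of `g ∧ g`: the common image of the two elements `x * y` of `g * g`. -/
def wedge : g →ₗ[K] g →ₗ[K] ExtSq K g :=
  (tmnB K).compr₂ (Quo.mk (box K g) (box_isIdeal K g)).toLinearMap

variable {K}

/-- The homomorphism `g ∧ g → h ∧ h` induced by `f : g → h`. -/
def extMap (f : Hom K g h) : Hom K (ExtSq K g) (ExtSq K h) :=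
  Quo.lift _ _ ((Quo.mk (box K h) (box_isIdeal K h)).comp (tensorMap f)) (by
    refine Submodule.span_le.2 ?_
    rintro _ ⟨x, y, rfl⟩
    refine (Submodule.Quotient.mk_eq_zero (box K h)).2 ?_
    exact Submodule.subset_span ⟨f x, f y, map_sub (tensorMap f).toLinearMap _ _⟩)

/-- The homomorphism `JL₂(g) → JL₂(h)` induced by `f : g → h`. -/
def JL2map (f : Hom K g h) : JL2 K g →ₗ[K] JL2 K h :=
  (tensorMap f).toLinearMap.restrict (by
    have hcomm : (lam K h).toLinearMap ∘ₗ (tensorMap f).toLinearMap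
        = f.toLinearMap ∘ₗ (lam K g).toLinearMap := by
      refine LinearMap.ext_on (span_tensor K g) ?_
      rintro _ (⟨⟨x, y⟩, rfl⟩ | ⟨⟨x, y⟩, rfl⟩)
      · exact (f.map_br x y).symm
      · exact (f.map_br x y).symm
    intro z hz
    have h1 := LinearMap.congr_fun hcomm z
    have hz' : (lam K g).toLinearMap z = 0 := hz
    rw [LinearMap.comp_apply, LinearMap.comp_apply, hz', map_zero] at h1
    exact h1)

variable (K g)

/-- The tensor center of `g`: all `x` with `α ^ k x * y = y * α ^ k x = 0` in `g * g` for all `y`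
and all `k ≥ 0`, for both kinds of symbols `*`. -/
def tensorCenter : Submodule K g where
  carrier := {x | ∀ (k : ℕ) (y : g),
    (tmn K ((al K ^ k) x) y = 0 ∧ tmn K y ((al K ^ k) x) = 0) ∧
    (tnm K ((al K ^ k) x) y = 0 ∧ tnm K y ((al K ^ k) x) = 0)}
  zero_mem' := by
    intro k y
    rw [map_zero]
    exact ⟨⟨(tmnB K).map_zero₂ y, (tmnB K y).map_zero⟩,
      ⟨(tnmB K).map_zero₂ y, (tnmB K y).map_zero⟩⟩
  add_mem' := by
    intro a b ha hb k y
    obtain ⟨⟨h1, h2⟩, h3, h4⟩ := ha k y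
    obtain ⟨⟨h1', h2'⟩, h3', h4'⟩ := hb k y
    simp only [map_add, tmn_add_left, tmn_add_right, tnm_add_left, tnm_add_right, h1, h2, h3, h4,
      h1', h2', h3', h4', add_zero, and_self]
  smul_mem' := by
    intro c a ha k y
    obtain ⟨⟨h1, h2⟩, h3, h4⟩ := ha k y
    simp only [map_smul, tmn_smul_left, tmn_smul_right, tnm_smul_left, tnm_smul_right, h1, h2, h3,
      h4, smul_zero, and_self]

/-- The exterior center of `g`: all `x` with `α ^ k x ∧ y = y ∧ α ^ k x = 0` in `g ∧ g` for all
`y` and all `k ≥ 0`. -/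
def extCenter : Submodule K g where
  carrier := {x | ∀ (k : ℕ) (y : g),
    wedge K ((al K ^ k) x) y = 0 ∧ wedge K y ((al K ^ k) x) = 0}
  zero_mem' := by
    intro k y
    simp
  add_mem' := by
    intro a b ha hb k y
    simp [(ha k y).1, (ha k y).2, (hb k y).1, (hb k y).2]
  smul_mem' := by
    intro c a ha k y
    simp [(ha k y).1, (ha k y).2]

end Tensor

section Homology

variable (K : Type u) [Field K] (g : Type v) [AddCommGroup g] [Module K g] [HomLeibniz K g]
variable {h : Type w} [AddCommGroup h] [Module K h] [HomLeibniz K h]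

/-- The boundary map `d₂ : g ⊗ g → g`, `x ⊗ y ↦ [x, y]`, of the Hom-Leibniz chain complex with
trivial coefficients. -/
def d2 : g ⊗[K] g →ₗ[K] g := TensorProduct.lift (br K)

/-- The boundary map `d₃ : g ⊗ g ⊗ g → g ⊗ g` of the Hom-Leibniz chain complex with trivial
coefficients,
`x ⊗ y ⊗ z ↦ -[x, y] ⊗ α z + α x ⊗ [y, z] + [x, z] ⊗ α y`. -/
def d3 : (g ⊗[K] g) ⊗[K] g →ₗ[K] g ⊗[K] g :=
  -(TensorProduct.map (d2 K g) (al K))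
    + (TensorProduct.map (al K) (d2 K g)) ∘ₗ (TensorProduct.assoc K g g g).toLinearMap
    + (TensorProduct.map (d2 K g) (al K)) ∘ₗ (TensorProduct.rightComm K g g g).toLinearMap

variable {g} in
theorem d3_tmul (x y z : g) : d3 K g ((x ⊗ₜ y) ⊗ₜ z) =
    -(br K x y ⊗ₜ al K z) + al K x ⊗ₜ br K y z + br K x z ⊗ₜ al K y := rfl

theorem d2_comp_d3 : d2 K g ∘ₗ d3 K g = 0 := by
  refine TensorProduct.ext_threefold fun x y z => ?_
  rw [LinearMap.comp_apply, d3_tmul]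
  simp only [d2, map_add, map_neg, TensorProduct.lift.tmul, leibniz, LinearMap.zero_apply]
  abel

/-- The second homology `HL₂(g) = ker d₂ / im d₃` of `g`. -/
abbrev HL2 : Type v :=
  LinearMap.ker (d2 K g) ⧸ (LinearMap.range (d3 K g)).submoduleOf (LinearMap.ker (d2 K g))

variable {K g}

theorem d2_map (f : Hom K g h) (z : g ⊗[K] g) :
    d2 K h (TensorProduct.map f.toLinearMap f.toLinearMap z) = f (d2 K g z) := by
  have : d2 K h ∘ₗ TensorProduct.map f.toLinearMap f.toLinearMap = f.toLinearMap ∘ₗ d2 K g :=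
    TensorProduct.ext' fun x y => (f.map_br x y).symm
  exact LinearMap.congr_fun this z

theorem d3_map (f : Hom K g h) (z : (g ⊗[K] g) ⊗[K] g) :
    d3 K h (TensorProduct.map (TensorProduct.map f.toLinearMap f.toLinearMap) f.toLinearMap z) =
      TensorProduct.map f.toLinearMap f.toLinearMap (d3 K g z) := by
  have : d3 K h ∘ₗ TensorProduct.map (TensorProduct.map f.toLinearMap f.toLinearMap) f.toLinearMap
      = TensorProduct.map f.toLinearMap f.toLinearMap ∘ₗ d3 K g := by
    refine TensorProduct.ext_threefold fun x y z => ?_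
    have hb : ∀ x y, f.toLinearMap (br K x y) = br K (f.toLinearMap x) (f.toLinearMap y) :=
      f.map_br
    have ha : ∀ x, f.toLinearMap (al K x) = al K (f.toLinearMap x) := f.map_al
    simp only [LinearMap.comp_apply, TensorProduct.map_tmul, d3_tmul, map_add, map_neg, hb, ha]
  exact LinearMap.congr_fun this z

/-- The linear map `HL₂(g) → HL₂(h)` induced by `f : g → h`. -/
def HL2map (f : Hom K g h) : HL2 K g →ₗ[K] HL2 K h :=
  Submodule.mapQ _ _
    ((TensorProduct.map f.toLinearMap f.toLinearMap).restrict (by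
      intro z hz
      have hz' : d2 K g z = 0 := hz
      rw [LinearMap.mem_ker, d2_map, hz']
      exact map_zero f.toLinearMap))
    (by
      rintro ⟨z, hz⟩ ⟨t, ht⟩
      exact ⟨_, (d3_map f t).trans
        (congrArg (TensorProduct.map f.toLinearMap f.toLinearMap) ht)⟩)

end Homology

end HomLeibniz

/-!
The exterior square `g ∧ g` is, as a vector space, the cokernel of `d₃`: a bilinear map `β` on `g`
factors through `∧` exactly when it satisfies the cocycle identity
`β(αx, [y, z]) = β([x, y], αz) - β([x, z], αy)` (`extLift`). Similarly linear maps out of `g * g`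
are pairs of cocycles which agree on `[g, g] × αg` and on `[g, g] × [g, g]` (`tensorLift`). As
`g * g` is defined by its property among Hom-Leibniz algebras, a cocycle `β : g × g → W` must first
be turned into a Hom-Leibniz algebra. This is the central extension `CocycleExt β` of `g` by
`ℕ → W` with the shift, the cofree Hom-vector space on `W`, with product `k ↦ β(α ^ k x, α ^ k y)`
in the second component.

For a surjective `f : g → h`, a linear map on `g * g` or `g ∧ g` that kills the elements with one
entry in `ker f` therefore factors through the map induced by `f` (`exists_factor_tensorMap`,
`exists_factor_extMap`). If `ker f` is central, this applies to the commutator map, so that the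
kernel of the induced map lies in `JL₂` or `HL₂`, which gives the equivalences in (iv) and (v). If
`ker f` is the tensor or exterior center, it applies to the identity, so that the induced map is
injective, which gives minimality. Part (ii) follows from the cocycles `(x, y) ↦ ψ x * ψ y`, where
`ψ` is a functional that vanishes on `[g, g]`: if `x ∧ x = 0`, then `ψ x ^ 2 = 0`.

For (iii), one inclusion is the factorization of `x ∧ y ↦ [x, y]`, `F ∧ F → F / [R, F]`, through
`g ∧ g`. For the other one, freeness of `F` gives a lift of `F → g` to `CocycleExt` of the cocycle
`∧`, hence a linear map `F → g ∧ g` with `[x, y] ↦ πx ∧ πy` (`IsFree.exists_linearMap_br`), which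
vanishes on `[R, F]`.
-/

namespace HomLeibniz

/-! ### Cocycles and the extensions they define -/

section Cocycle

variable {K : Type u} [Field K] {g : Type v} [AddCommGroup g] [Module K g] [HomLeibniz K g]
variable {W : Type w} [AddCommGroup W] [Module K W]

theorem al_pow_al (k : ℕ) (x : g) : (al K ^ k) (al K x) = al K ((al K ^ k) x) := by
  rw [← Module.End.mul_apply, ← Module.End.mul_apply, ← pow_succ, ← pow_succ']

theorem al_pow_succ (k : ℕ) (x : g) : (al K ^ (k + 1)) x = al K ((al K ^ k) x) := by
  rw [pow_succ', Module.End.mul_apply]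

theorem al_pow_br (k : ℕ) (x y : g) :
    (al K ^ k) (br K x y) = br K ((al K ^ k) x) ((al K ^ k) y) := by
  induction k with
  | zero => rfl
  | succ k ih => rw [al_pow_succ, al_pow_succ, al_pow_succ, ih, al_br]

theorem Hom.map_al_pow {h : Type w'} [AddCommGroup h] [Module K h] [HomLeibniz K h]
    (f : Hom K g h) (k : ℕ) (x : g) : f ((al K ^ k) x) = (al K ^ k) (f x) := by
  induction k with
  | zero => rfl
  | succ k ih => rw [al_pow_succ, al_pow_succ, ← ih]; exact f.map_al _

theorem al_pow_mem {S : Submodule K g} (hS : ∀ x ∈ S, al K x ∈ S) (k : ℕ) {x : g} (hx : x ∈ S) :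
    (al K ^ k) x ∈ S := by
  induction k with
  | zero => exact hx
  | succ k ih => rw [al_pow_succ]; exact hS _ ih

/-- Bilinear maps `β` on `g` that vanish on the boundaries `d₃ (x ⊗ y ⊗ z)`. No self-map of the
target and no compatibility of `β` with `α` is involved. -/
def IsCocycle (β : g →ₗ[K] g →ₗ[K] W) : Prop :=
  ∀ x y z : g, β (al K x) (br K y z) = β (br K x y) (al K z) - β (br K x z) (al K y)

/-- The extension of `g` defined by a cocycle `β : g × g → W`: the space `g × (ℕ → W)` with
product `[(x, c), (y, d)] = ([x, y], k ↦ β (α ^ k x) (α ^ k y))`, and with `α` acting on `ℕ → W` as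
the shift. Sequences make the component at `0` an arbitrary cocycle, although `W` has no
self-map. -/
def CocycleExt (β : g →ₗ[K] g →ₗ[K] W) (_hβ : IsCocycle β) : Type (max v w) := g × (ℕ → W)

variable (β : g →ₗ[K] g →ₗ[K] W) (hβ : IsCocycle β)

instance : AddCommGroup (CocycleExt β hβ) := inferInstanceAs (AddCommGroup (g × (ℕ → W)))

instance : Module K (CocycleExt β hβ) := inferInstanceAs (Module K (g × (ℕ → W)))

/-- The bilinear map `(x, y) ↦ ([x, y], k ↦ γ (α ^ k x) (α ^ k y))` into the extension of `g`
defined by `β`. For `γ = β` it gives the product of the extension. -/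
def pairing (γ : g →ₗ[K] g →ₗ[K] W) : g →ₗ[K] g →ₗ[K] CocycleExt β hβ :=
  LinearMap.mk₂ (M := g) (Nₗ := g) (Pₗ := g × (ℕ → W)) K
    (fun x y => (br K x y, fun k => γ ((al K ^ k) x) ((al K ^ k) y)))
    (fun x x' y => by ext <;> simp) (fun c x y => by ext <;> simp)
    (fun x y y' => by ext <;> simp) (fun c x y => by ext <;> simp)

instance : HomLeibniz K (CocycleExt β hβ) where
  br := (pairing β hβ β).compl₁₂ (LinearMap.fst K g (ℕ → W)) (LinearMap.fst K g (ℕ → W))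
  al := (al K).prodMap (LinearMap.funLeft K W Nat.succ)
  al_br p q := by
    refine Prod.ext (al_br p.1 q.1) (funext fun k => ?_)
    change β ((al K ^ (k + 1)) p.1) ((al K ^ (k + 1)) q.1)
      = β ((al K ^ k) (al K p.1)) ((al K ^ k) (al K q.1))
    simp only [al_pow_succ, al_pow_al]
  leibniz p q r := by
    refine Prod.ext (leibniz p.1 q.1 r.1) (funext fun k => ?_)
    change β ((al K ^ k) (al K p.1)) ((al K ^ k) (br K q.1 r.1))
      = β ((al K ^ k) (br K p.1 q.1)) ((al K ^ k) (al K r.1))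
        - β ((al K ^ k) (br K p.1 r.1)) ((al K ^ k) (al K q.1))
    simp only [al_pow_al, al_pow_br]
    exact hβ _ _ _

/-- The projection of the extension onto `g`. -/
def CocycleExt.fst : Hom K (CocycleExt β hβ) g where
  toLinearMap := LinearMap.fst K g (ℕ → W)
  map_al := fun _ => rfl
  map_br := fun _ _ => rfl

/-- The component at `0` of the kernel part of the extension. -/
def CocycleExt.snd : CocycleExt β hβ →ₗ[K] W := LinearMap.proj 0 ∘ₗ LinearMap.snd K g (ℕ → W)

end Cocycle

/-! ### Linear maps out of the tensor and exterior squares -/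

section UniversalProperty

variable {K : Type u} [Field K] {g : Type v} [AddCommGroup g] [Module K g] [HomLeibniz K g]
variable {W : Type w} [AddCommGroup W] [Module K W]

/-- Pairs of cocycles that define a linear map on `g * g`. Given the cocycle identity for `β₁` and
`β₂`, relation (3) is automatic, the mixed relations in (4) amount to `br_al`, and those in (5)
to `br_br`. -/
structure IsTensorPair (β₁ β₂ : g →ₗ[K] g →ₗ[K] W) : Prop where
  left : IsCocycle β₁
  right : IsCocycle β₂
  br_al : ∀ x y z : g, β₁ (br K x y) (al K z) = β₂ (br K x y) (al K z)
  br_br : ∀ x y z t : g, β₁ (br K x y) (br K z t) = β₂ (br K x y) (br K z t)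

theorem IsTensorPair.pairing {β₁ β₂ : g →ₗ[K] g →ₗ[K] W} (hβ : IsTensorPair β₁ β₂)
    {β : g →ₗ[K] g →ₗ[K] W} (h : IsCocycle β) :
    IsTensorPair (pairing β h β₁) (pairing β h β₂) := by
  refine ⟨fun x y z => Prod.ext (leibniz x y z) (funext fun k => ?_),
    fun x y z => Prod.ext (leibniz x y z) (funext fun k => ?_),
    fun x y z => Prod.ext rfl (funext fun k => ?_),
    fun x y z t => Prod.ext rfl (funext fun k => ?_)⟩
  · change β₁ ((al K ^ k) (al K x)) ((al K ^ k) (br K y z))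
      = β₁ ((al K ^ k) (br K x y)) ((al K ^ k) (al K z))
        - β₁ ((al K ^ k) (br K x z)) ((al K ^ k) (al K y))
    simp only [al_pow_al, al_pow_br]
    exact hβ.left _ _ _
  · change β₂ ((al K ^ k) (al K x)) ((al K ^ k) (br K y z))
      = β₂ ((al K ^ k) (br K x y)) ((al K ^ k) (al K z))
        - β₂ ((al K ^ k) (br K x z)) ((al K ^ k) (al K y))
    simp only [al_pow_al, al_pow_br]
    exact hβ.right _ _ _
  · change β₁ ((al K ^ k) (br K x y)) ((al K ^ k) (al K z))
      = β₂ ((al K ^ k) (br K x y)) ((al K ^ k) (al K z))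
    simp only [al_pow_al, al_pow_br]
    exact hβ.br_al _ _ _
  · change β₁ ((al K ^ k) (br K x y)) ((al K ^ k) (br K z t))
      = β₂ ((al K ^ k) (br K x y)) ((al K ^ k) (br K z t))
    simp only [al_pow_br]
    exact hβ.br_br _ _ _ _

theorem al_pairing {β : g →ₗ[K] g →ₗ[K] W} (hβ : IsCocycle β) (γ : g →ₗ[K] g →ₗ[K] W) (x y : g) :
    al K (pairing β hβ γ x y) = pairing β hβ γ (al K x) (al K y) := by
  refine Prod.ext (al_br x y) (funext fun k => ?_)
  change γ ((al K ^ (k + 1)) x) ((al K ^ (k + 1)) y)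
    = γ ((al K ^ k) (al K x)) ((al K ^ k) (al K y))
  simp only [al_pow_succ, al_pow_al]

theorem br_pairing {β : g →ₗ[K] g →ₗ[K] W} (hβ : IsCocycle β) (γ δ : g →ₗ[K] g →ₗ[K] W)
    (x y z t : g) : br K (pairing β hβ γ x y) (pairing β hβ δ z t)
      = pairing β hβ β (br K x y) (br K z t) :=
  rfl

/-- The homomorphism from `g * g` to the extension of `g` defined by `β₁`, with values given by
`β₁` and `β₂` on the two families of symbols. -/
def tensorLiftHom (β₁ β₂ : g →ₗ[K] g →ₗ[K] W) (hβ : IsTensorPair β₁ β₂) :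
    Hom K (TensorSq K g) (CocycleExt β₁ hβ.left) :=
  Presented.lift
    (TensorGen.elim (fun x y => pairing β₁ hβ.left β₁ x y)
      (fun x y => pairing β₁ hβ.left β₂ x y)) (by
    have h := hβ.pairing hβ.left
    have hbr := h.br_br
    intro a b hab
    cases hab <;>
      simp only [Term.eval, TensorGen.elim, map_smul, map_add, LinearMap.smul_apply,
        LinearMap.add_apply, h.left _ _ _, h.right _ _ _, al_pairing, br_pairing, hbr, neg_smul,
        one_smul, neg_sub, h.br_al] <;> abel)

/-- The linear map `g * g → W` defined by a pair of cocycles, with values `β₁ x y` and `β₂ x y` on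
the symbols `x * y` of the two kinds. -/
def tensorLift (β₁ β₂ : g →ₗ[K] g →ₗ[K] W) (hβ : IsTensorPair β₁ β₂) : TensorSq K g →ₗ[K] W :=
  CocycleExt.snd β₁ hβ.left ∘ₗ (tensorLiftHom β₁ β₂ hβ).toLinearMap

theorem IsCocycle.isTensorPair {β : g →ₗ[K] g →ₗ[K] W} (hβ : IsCocycle β) : IsTensorPair β β :=
  ⟨hβ, hβ, fun _ _ _ => rfl, fun _ _ _ _ => rfl⟩

/-- The linear map `g ∧ g → W`, `x ∧ y ↦ β x y`, defined by a cocycle `β`. -/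
def extLift (β : g →ₗ[K] g →ₗ[K] W) (hβ : IsCocycle β) : ExtSq K g →ₗ[K] W :=
  (box K g).liftQ (tensorLift β β hβ.isTensorPair) (by
    refine Submodule.span_le.2 ?_
    rintro _ ⟨x, y, rfl⟩
    exact (map_sub _ _ _).trans (sub_self (β x y)))

theorem isTensorPair_tmnB_tnmB : IsTensorPair (tmnB K (g := g)) (tnmB K) := by
  have hl : IsCocycle (tmnB K (g := g)) := fun x y z => by
    rw [sub_eq_add_neg, ← neg_one_smul K]
    exact Quot.sound (.of (.r4a x y z))
  have hr : IsCocycle (tnmB K (g := g)) := fun x y z => by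
    rw [sub_eq_add_neg, ← neg_one_smul K]
    exact Quot.sound (.of (.r4b y z x))
  refine ⟨hl, hr, fun x y z => ?_, fun x y z t => ?_⟩
  -- Comparing the mixed relation in (4) with the cocycle identity identifies the two symbols here.
  · have h : tmnB K (br K x z) (al K y)
        = tnmB K (br K x y) (al K z) + (-1 : K) • tmnB K (al K x) (br K y z) :=
      Quot.sound (.of (.r4c x z y))
    rw [hl, neg_one_smul, neg_sub, ← sub_eq_zero] at h
    rw [← sub_eq_zero, ← h]
    abel
  · exact (br_tmn_tmn K x y z t).symm.trans (Quot.sound (.of (.r5a' x y z t)))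

theorem isCocycle_wedge : IsCocycle (wedge K (g := g)) := fun x y z =>
  (congrArg (Quo.mk (box K g) (box_isIdeal K g)).toLinearMap
    (isTensorPair_tmnB_tnmB.left x y z)).trans (map_sub _ _ _)

theorem tensorSq_linearMap_ext {φ ψ : TensorSq K g →ₗ[K] W}
    (h₁ : ∀ x y, φ (tmn K x y) = ψ (tmn K x y)) (h₂ : ∀ x y, φ (tnm K x y) = ψ (tnm K x y)) :
    φ = ψ := by
  refine LinearMap.ext_on (span_tensor K g) ?_
  rintro _ (⟨⟨x, y⟩, rfl⟩ | ⟨⟨x, y⟩, rfl⟩)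
  · exact h₁ x y
  · exact h₂ x y

theorem mk_tnm (x y : g) : Quo.mk (box K g) (box_isIdeal K g) (tnm K x y) = wedge K x y :=
  ((Submodule.Quotient.eq (box K g)).2 (Submodule.subset_span ⟨x, y, rfl⟩)).symm

theorem extSq_linearMap_ext {φ ψ : ExtSq K g →ₗ[K] W}
    (h : ∀ x y, φ (wedge K x y) = ψ (wedge K x y)) : φ = ψ := by
  have : φ ∘ₗ (Quo.mk (box K g) (box_isIdeal K g)).toLinearMap
      = ψ ∘ₗ (Quo.mk (box K g) (box_isIdeal K g)).toLinearMap := by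
    refine tensorSq_linearMap_ext (fun x y => h x y) fun x y => ?_
    have hx := h x y
    rw [← mk_tnm] at hx
    exact hx
  refine LinearMap.ext fun u => ?_
  obtain ⟨u, rfl⟩ := (box K g).mkQ_surjective u
  exact LinearMap.congr_fun this u

theorem extMap_wedge {h : Type w'} [AddCommGroup h] [Module K h] [HomLeibniz K h] (f : Hom K g h)
    (x y : g) : extMap f (wedge K x y) = wedge K (f x) (f y) := rfl

variable (K g) in
/-- The commutator map `g ∧ g → g`, `x ∧ y ↦ [x, y]`. -/
def extLam : ExtSq K g →ₗ[K] g := extLift (br K) leibniz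

variable (K g) in
/-- The canonical map `g ⊗ g → g ∧ g`. -/
def toExt : g ⊗[K] g →ₗ[K] ExtSq K g := TensorProduct.lift (wedge K)

@[simp] theorem toExt_tmul (x y : g) : toExt K g (x ⊗ₜ y) = wedge K x y := rfl

theorem toExt_surjective : Function.Surjective (toExt K g) := by
  rw [← LinearMap.range_eq_top, ← Submodule.ker_mkQ (LinearMap.range (toExt K g)),
    LinearMap.ker_eq_top]
  refine extSq_linearMap_ext fun x y => (Submodule.Quotient.mk_eq_zero _).2 ⟨x ⊗ₜ y, rfl⟩

/-- As a vector space, `g ∧ g` is the cokernel of `d₃`. -/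
theorem ker_toExt : LinearMap.ker (toExt K g) = LinearMap.range (d3 K g) := by
  apply le_antisymm
  · let q := (LinearMap.range (d3 K g)).mkQ
    let β : g →ₗ[K] g →ₗ[K] (g ⊗[K] g ⧸ LinearMap.range (d3 K g)) :=
      (TensorProduct.mk K g g).compr₂ q
    have hβ : IsCocycle β := fun x y z => by
      have h : q (d3 K g ((x ⊗ₜ y) ⊗ₜ z)) = 0 := (Submodule.Quotient.mk_eq_zero _).2 ⟨_, rfl⟩
      rw [d3_tmul, map_add, map_add, map_neg] at h
      change q (al K x ⊗ₜ br K y z) = q (br K x y ⊗ₜ al K z) - q (br K x z ⊗ₜ al K y)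
      rw [eq_sub_iff_add_eq, ← sub_eq_zero, ← h]
      abel
    have hq : extLift β hβ ∘ₗ toExt K g = q := TensorProduct.ext' fun x y => rfl
    intro u hu
    rw [← Submodule.ker_mkQ (LinearMap.range (d3 K g)), LinearMap.mem_ker]
    change q u = 0
    rw [← hq, LinearMap.comp_apply, LinearMap.mem_ker.1 hu, map_zero]
  · rintro _ ⟨u, rfl⟩
    have : toExt K g ∘ₗ d3 K g = 0 := TensorProduct.ext_threefold fun x y z => by
      rw [LinearMap.comp_apply, d3_tmul]
      simp only [map_add, map_neg, toExt_tmul, isCocycle_wedge x y z, LinearMap.zero_apply]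
      abel
    exact LinearMap.congr_fun this u

theorem extLam_toExt (u : g ⊗[K] g) : extLam K g (toExt K g u) = d2 K g u := by
  have : extLam K g ∘ₗ toExt K g = d2 K g := TensorProduct.ext' fun x y => rfl
  exact LinearMap.congr_fun this u

end UniversalProperty

/-! ### Factorization through a surjective homomorphism -/

section Factorization

theorem exists_bilinear_factor {K : Type u} [Field K] {g : Type v} [AddCommGroup g] [Module K g]
    {h : Type w} [AddCommGroup h] [Module K h] {W : Type w'} [AddCommGroup W] [Module K W]
    {f : g →ₗ[K] h} (hf : Function.Surjective f) (β : g →ₗ[K] g →ₗ[K] W)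
    (hl : ∀ x ∈ LinearMap.ker f, ∀ y, β x y = 0) (hr : ∀ x ∈ LinearMap.ker f, ∀ y, β y x = 0) :
    ∃ γ : h →ₗ[K] h →ₗ[K] W, ∀ x y, γ (f x) (f y) = β x y := by
  obtain ⟨s, hs⟩ := f.exists_rightInverse_of_surjective (LinearMap.range_eq_top.2 hf)
  have hs' : ∀ x, s (f x) - x ∈ LinearMap.ker f := fun x => by
    rw [LinearMap.mem_ker, map_sub, sub_eq_zero]
    exact LinearMap.congr_fun hs (f x)
  refine ⟨β.compl₁₂ s s, fun x y => ?_⟩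
  have h₁ := hl _ (hs' x) (s (f y))
  have h₂ := hr _ (hs' y) x
  rw [map_sub, LinearMap.sub_apply, sub_eq_zero] at h₁
  rw [map_sub, sub_eq_zero] at h₂
  exact h₁.trans h₂

variable {K : Type u} [Field K] {g : Type v} [AddCommGroup g] [Module K g] [HomLeibniz K g]
variable {h : Type w} [AddCommGroup h] [Module K h] [HomLeibniz K h]
variable {W : Type w'} [AddCommGroup W] [Module K W]

theorem IsCocycle.of_surjective {f : Hom K g h} (hf : Function.Surjective f)
    {β : g →ₗ[K] g →ₗ[K] W} (hβ : IsCocycle β) {γ : h →ₗ[K] h →ₗ[K] W}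
    (hγ : ∀ x y, γ (f x) (f y) = β x y) : IsCocycle γ := by
  have ha : ∀ x, al K (f x) = f (al K x) := fun x => (f.map_al x).symm
  have hb : ∀ x y, br K (f x) (f y) = f (br K x y) := fun x y => (f.map_br x y).symm
  intro x y z
  obtain ⟨x, rfl⟩ := hf x
  obtain ⟨y, rfl⟩ := hf y
  obtain ⟨z, rfl⟩ := hf z
  simp only [ha, hb, hγ]
  exact hβ x y z

theorem IsTensorPair.of_surjective {f : Hom K g h} (hf : Function.Surjective f)
    {β₁ β₂ : g →ₗ[K] g →ₗ[K] W} (hβ : IsTensorPair β₁ β₂) {γ₁ γ₂ : h →ₗ[K] h →ₗ[K] W}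
    (h₁ : ∀ x y, γ₁ (f x) (f y) = β₁ x y) (h₂ : ∀ x y, γ₂ (f x) (f y) = β₂ x y) :
    IsTensorPair γ₁ γ₂ := by
  have ha : ∀ x, al K (f x) = f (al K x) := fun x => (f.map_al x).symm
  have hb : ∀ x y, br K (f x) (f y) = f (br K x y) := fun x y => (f.map_br x y).symm
  refine ⟨hβ.left.of_surjective hf h₁, hβ.right.of_surjective hf h₂, fun x y z => ?_,
    fun x y z t => ?_⟩
  · obtain ⟨x, rfl⟩ := hf x
    obtain ⟨y, rfl⟩ := hf y
    obtain ⟨z, rfl⟩ := hf z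
    simp only [ha, hb, h₁, h₂]
    exact hβ.br_al x y z
  · obtain ⟨x, rfl⟩ := hf x
    obtain ⟨y, rfl⟩ := hf y
    obtain ⟨z, rfl⟩ := hf z
    obtain ⟨t, rfl⟩ := hf t
    simp only [hb, h₁, h₂]
    exact hβ.br_br x y z t

/-- Since `W` is arbitrary, this says that the kernel of `tensorMap f` is spanned by the elements
`x * y` with an entry in the kernel of `f`. -/
theorem exists_factor_tensorMap {f : Hom K g h} (hf : Function.Surjective f)
    (ψ : TensorSq K g →ₗ[K] W)
    (hψ : ∀ x ∈ LinearMap.ker f.toLinearMap, ∀ y, (ψ (tmn K x y) = 0 ∧ ψ (tmn K y x) = 0) ∧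
      (ψ (tnm K x y) = 0 ∧ ψ (tnm K y x) = 0)) :
    ∃ φ : TensorSq K h →ₗ[K] W, ∀ u, φ (tensorMap f u) = ψ u := by
  have hp := isTensorPair_tmnB_tnmB (K := K) (g := g)
  obtain ⟨γ₁, h₁⟩ := exists_bilinear_factor (f := f.toLinearMap) hf ((tmnB K).compr₂ ψ)
    (fun x hx y => (hψ x hx y).1.1) (fun x hx y => (hψ x hx y).1.2)
  obtain ⟨γ₂, h₂⟩ := exists_bilinear_factor (f := f.toLinearMap) hf ((tnmB K).compr₂ ψ)
    (fun x hx y => (hψ x hx y).2.1) (fun x hx y => (hψ x hx y).2.2)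
  have hβ : IsTensorPair ((tmnB K).compr₂ ψ) ((tnmB K).compr₂ ψ) :=
    ⟨fun x y z => (congrArg ψ (hp.left x y z)).trans (map_sub ψ _ _),
      fun x y z => (congrArg ψ (hp.right x y z)).trans (map_sub ψ _ _),
      fun x y z => congrArg ψ (hp.br_al x y z), fun x y z t => congrArg ψ (hp.br_br x y z t)⟩
  refine ⟨tensorLift γ₁ γ₂ (hβ.of_surjective hf h₁ h₂), LinearMap.congr_fun
    (f := tensorLift γ₁ γ₂ (hβ.of_surjective hf h₁ h₂) ∘ₗ (tensorMap f).toLinearMap) ?_⟩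
  exact tensorSq_linearMap_ext h₁ h₂

/-- Since `W` is arbitrary, this says that the kernel of `extMap f` is spanned by the elements
`x ∧ y` with an entry in the kernel of `f`. -/
theorem exists_factor_extMap {f : Hom K g h} (hf : Function.Surjective f) (ψ : ExtSq K g →ₗ[K] W)
    (hψ : ∀ x ∈ LinearMap.ker f.toLinearMap, ∀ y, ψ (wedge K x y) = 0 ∧ ψ (wedge K y x) = 0) :
    ∃ φ : ExtSq K h →ₗ[K] W, ∀ u, φ (extMap f u) = ψ u := by
  obtain ⟨γ, hγ⟩ := exists_bilinear_factor (f := f.toLinearMap) hf ((wedge K).compr₂ ψ)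
    (fun x hx y => (hψ x hx y).1) (fun x hx y => (hψ x hx y).2)
  have hβ : IsCocycle ((wedge K (g := g)).compr₂ ψ) :=
    fun x y z => (congrArg ψ (isCocycle_wedge x y z)).trans (map_sub ψ _ _)
  exact ⟨extLift γ (hβ.of_surjective hf hγ), LinearMap.congr_fun
    (f := extLift γ (hβ.of_surjective hf hγ) ∘ₗ (extMap f).toLinearMap) (extSq_linearMap_ext hγ)⟩

theorem tensorMap_surjective {f : Hom K g h} (hf : Function.Surjective f) :
    Function.Surjective (tensorMap f) := by
  change Function.Surjective (tensorMap f).toLinearMap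
  rw [← LinearMap.range_eq_top, ← Submodule.ker_mkQ (LinearMap.range (tensorMap f).toLinearMap),
    LinearMap.ker_eq_top]
  refine tensorSq_linearMap_ext (fun x y => (Submodule.Quotient.mk_eq_zero _).2 ?_)
    fun x y => (Submodule.Quotient.mk_eq_zero _).2 ?_
  · obtain ⟨x, rfl⟩ := hf x
    obtain ⟨y, rfl⟩ := hf y
    exact ⟨tmn K x y, rfl⟩
  · obtain ⟨x, rfl⟩ := hf x
    obtain ⟨y, rfl⟩ := hf y
    exact ⟨tnm K x y, rfl⟩

theorem extMap_surjective {f : Hom K g h} (hf : Function.Surjective f) :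
    Function.Surjective (extMap f) := by
  change Function.Surjective (extMap f).toLinearMap
  rw [← LinearMap.range_eq_top, ← Submodule.ker_mkQ (LinearMap.range (extMap f).toLinearMap),
    LinearMap.ker_eq_top]
  refine extSq_linearMap_ext fun x y => (Submodule.Quotient.mk_eq_zero _).2 ?_
  obtain ⟨x, rfl⟩ := hf x
  obtain ⟨y, rfl⟩ := hf y
  exact ⟨wedge K x y, rfl⟩

end Factorization

/-! ### The tensor center and the exterior center -/

section Centers

variable {K : Type u} [Field K] {g : Type v} [AddCommGroup g] [Module K g] [HomLeibniz K g]

theorem isCentralIdeal_tensorCenter : IsCentralIdeal (tensorCenter K g) := by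
  have hc : tensorCenter K g ≤ center K g := fun x hx y =>
    ⟨(congrArg (lam K g) (hx 0 y).1.1).trans (map_zero (lam K g).toLinearMap),
      (congrArg (lam K g) (hx 0 y).1.2).trans (map_zero (lam K g).toLinearMap)⟩
  refine ⟨⟨fun _ hx k y => ?_, fun x hx y => ?_, fun x hx y => ?_⟩, hc⟩
  · rw [al_pow_al, ← al_pow_succ]
    exact hx (k + 1) y
  · rw [(hc hx y).1]; exact Submodule.zero_mem _
  · rw [(hc hx y).2]; exact Submodule.zero_mem _

theorem isCentralIdeal_extCenter : IsCentralIdeal (extCenter K g) := by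
  have hc : extCenter K g ≤ center K g := fun x hx y =>
    ⟨(congrArg (extLam K g) (hx 0 y).1).trans (map_zero (extLam K g)),
      (congrArg (extLam K g) (hx 0 y).2).trans (map_zero (extLam K g))⟩
  refine ⟨⟨fun _ hx k y => ?_, fun x hx y => ?_, fun x hx y => ?_⟩, hc⟩
  · rw [al_pow_al, ← al_pow_succ]
    exact hx (k + 1) y
  · rw [(hc hx y).1]; exact Submodule.zero_mem _
  · rw [(hc hx y).2]; exact Submodule.zero_mem _

theorem IsCentralIdeal.isCentralSubalgebra {S : Submodule K g} (hS : IsCentralIdeal S) :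
    IsCentralSubalgebra S :=
  ⟨⟨hS.al_mem, fun x hx y _ => hS.br_mem_left x hx y⟩, hS.le_center⟩

theorem tensorCenter_le_extCenter : tensorCenter K g ≤ extCenter K g := fun _ hx k y =>
  ⟨(congrArg (Quo.mk (box K g) (box_isIdeal K g)) (hx k y).1.1).trans (map_zero (box K g).mkQ),
    (congrArg (Quo.mk (box K g) (box_isIdeal K g)) (hx k y).1.2).trans (map_zero (box K g).mkQ)⟩

theorem extCenter_le_commutator : extCenter K g ≤ commutator ⊤ ⊤ := by
  intro x hx
  rw [← Submodule.Quotient.mk_eq_zero, ← Module.forall_dual_apply_eq_zero_iff K]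
  intro φ
  let ψ : g →ₗ[K] K := φ ∘ₗ (commutator (K := K) (g := g) ⊤ ⊤).mkQ
  have hψ : ∀ y z : g, ψ (br K y z) = 0 := fun y z =>
    (congrArg φ ((Submodule.Quotient.mk_eq_zero _).2
      (Submodule.subset_span ⟨y, trivial, z, trivial, .inl rfl⟩))).trans (map_zero φ)
  let β : g →ₗ[K] g →ₗ[K] K := (LinearMap.mul K K).compl₁₂ ψ ψ
  have hβ : IsCocycle β := fun x y z => by
    change ψ (al K x) * ψ (br K y z)
      = ψ (br K x y) * ψ (al K z) - ψ (br K x z) * ψ (al K y)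
    simp only [hψ, zero_mul, mul_zero, sub_zero]
  have h : ψ x * ψ x = 0 := (congrArg (extLift β hβ) (hx 0 x).1).trans (map_zero _)
  exact mul_self_eq_zero.1 h

end Centers

/-! ### Free presentations -/

section FreePresentations

variable {K : Type u} [Field K] {g : Type v} [AddCommGroup g] [Module K g] [HomLeibniz K g]

theorem freeHomLeibniz_hom_ext {V : Type w} [AddCommGroup V] [Module K V] {aV : V →ₗ[K] V}
    {φ ψ : Hom K (FreeHomLeibniz K aV) g}
    (h : ∀ v, φ (Presented.mk _ (.gen v)) = ψ (Presented.mk _ (.gen v)))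
    (u : FreeHomLeibniz K aV) : φ u = ψ u := by
  obtain ⟨a⟩ := u
  change φ (Presented.mk _ a) = ψ (Presented.mk _ a)
  induction a with
  | gen v => exact h v
  | zero => exact (map_zero φ.toLinearMap).trans (map_zero ψ.toLinearMap).symm
  | add a b ha hb =>
    exact (map_add φ.toLinearMap _ _).trans
      ((congrArg₂ (· + ·) ha hb).trans (map_add ψ.toLinearMap _ _).symm)
  | smul c a ha =>
    exact (map_smul φ.toLinearMap c _).trans
      ((congrArg (c • ·) ha).trans (map_smul ψ.toLinearMap c _).symm)
  | br a b ha hb =>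
    exact (φ.map_br _ _).trans ((congrArg₂ (fun x y => br K x y) ha hb).trans (ψ.map_br _ _).symm)
  | al a ha => exact (φ.map_al _).trans ((congrArg (al K) ha).trans (ψ.map_al _).symm)

/-- Every cocycle on `g` becomes a coboundary on a free Hom-Leibniz algebra over `g`, because the
extension that it defines splits there. -/
theorem IsFree.exists_linearMap_br {F : Type w} [AddCommGroup F] [Module K F] [HomLeibniz K F]
    (hF : IsFree.{u, w, w'} K F) (π : Hom K F g) {W : Type*} [AddCommGroup W] [Module K W]
    (β : g →ₗ[K] g →ₗ[K] W) (hβ : IsCocycle β) :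
    ∃ φ : F →ₗ[K] W, ∀ x y, φ (br K x y) = β (π x) (π y) := by
  obtain ⟨V, _, _, aV, e, he⟩ := hF
  let ι : V → FreeHomLeibniz K aV := fun v => Presented.mk _ (.gen v)
  -- The zero component is compatible with `α`, so `s` is a map of Hom-vector spaces.
  let s : V → CocycleExt β hβ := fun v => (π (e (ι v)), 0)
  let σ : Hom K (FreeHomLeibniz K aV) (CocycleExt β hβ) := Presented.lift s (by
    intro a b hab
    cases hab with
    | add x y =>
      have : ι (x + y) = ι x + ι y := Quot.sound (.of (.add x y))
      refine Prod.ext ?_ (add_zero (0 : ℕ → W)).symm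
      change π (e (ι (x + y))) = π (e (ι x)) + π (e (ι y))
      rw [this]
      exact map_add (π.comp e).toLinearMap _ _
    | smul c x =>
      have : ι (c • x) = c • ι x := Quot.sound (.of (.smul c x))
      refine Prod.ext ?_ (smul_zero c (A := ℕ → W)).symm
      change π (e (ι (c • x))) = c • π (e (ι x))
      rw [this]
      exact map_smul (π.comp e).toLinearMap _ _
    | al x =>
      have : ι (aV x) = al K (ι x) := Quot.sound (.of (.al x))
      refine Prod.ext ?_ rfl
      change π (e (ι (aV x))) = al K (π (e (ι x)))
      rw [this]
      exact (π.comp e).map_al _)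
  have hσ : ∀ u, CocycleExt.fst β hβ (σ u) = π (e u) :=
    freeHomLeibniz_hom_ext (φ := (CocycleExt.fst β hβ).comp σ) (ψ := π.comp e)
      fun _ => rfl
  let e' := LinearEquiv.ofBijective e.toLinearMap he
  refine ⟨CocycleExt.snd β hβ ∘ₗ σ.toLinearMap ∘ₗ e'.symm.toLinearMap, fun x y => ?_⟩
  obtain ⟨x, rfl⟩ := he.2 x
  obtain ⟨y, rfl⟩ := he.2 y
  have h : e'.symm (br K (e x) (e y)) = br K x y :=
    (LinearEquiv.symm_apply_eq e').2 (e.map_br x y).symm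
  change CocycleExt.snd β hβ (σ (e'.symm (br K (e x) (e y)))) = _
  rw [h, ← hσ x, ← hσ y]
  exact congrArg (CocycleExt.snd β hβ) (σ.map_br x y)

theorem extCenter_eq_map_piBar {F : Type w} [AddCommGroup F] [Module K F] [HomLeibniz K F]
    (hF : IsFree.{u, w, w'} K F) (π : Hom K F g) (hπ : Function.Surjective π) :
    extCenter K g = (alphaCenter K (CentralQuo π)).map (piBar π).toLinearMap := by
  let R := LinearMap.ker π.toLinearMap
  let q := Quo.mk (commutator R ⊤) (commutator_top_isIdeal π.ker_isIdeal)
  have hq : Function.Surjective q := (commutator R ⊤).mkQ_surjective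
  have hpi : ∀ a, piBar π (q a) = π a := fun _ => rfl
  have hq0 : ∀ a, q a = 0 ↔ a ∈ commutator R ⊤ := fun a => Submodule.Quotient.mk_eq_zero _
  apply le_antisymm
  · obtain ⟨φ, hφ⟩ := exists_factor_extMap hπ (q.toLinearMap ∘ₗ extLam K F) fun x hx y =>
      ⟨(hq0 _).2 (Submodule.subset_span ⟨x, hx, y, trivial, .inl rfl⟩),
        (hq0 _).2 (Submodule.subset_span ⟨x, hx, y, trivial, .inr rfl⟩)⟩
    have hφ' : ∀ a b, φ (wedge K (π a) (π b)) = br K (q a) (q b) := fun a b =>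
      (hφ (wedge K a b)).trans (q.map_br a b)
    intro x hx
    obtain ⟨a, rfl⟩ := hπ x
    refine ⟨q a, fun k b => ?_, hpi a⟩
    obtain ⟨b, rfl⟩ := hq b
    rw [← q.map_al_pow, ← hφ', ← hφ', π.map_al_pow, (hx k (π b)).1, (hx k (π b)).2, map_zero]
    exact ⟨rfl, rfl⟩
  · obtain ⟨φ, hφ⟩ := hF.exists_linearMap_br π (wedge K) isCocycle_wedge
    have hφ0 : ∀ a ∈ commutator R ⊤, φ a = 0 := by
      have : commutator R ⊤ ≤ LinearMap.ker φ := by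
        refine Submodule.span_le.2 ?_
        rintro _ ⟨r, hr, t, -, rfl | rfl⟩
        · have hr' : π r = 0 := hr
          exact (hφ r t).trans (by rw [hr', map_zero, LinearMap.zero_apply])
        · have hr' : π r = 0 := hr
          exact (hφ t r).trans (by rw [hr', map_zero])
      exact fun a ha => this ha
    rintro _ ⟨x, hx, rfl⟩ k y
    obtain ⟨a, rfl⟩ := hq x
    obtain ⟨b, rfl⟩ := hπ y
    obtain ⟨h₁, h₂⟩ := hx k (q b)
    rw [← q.map_al_pow] at h₁ h₂
    change wedge K ((al K ^ k) (π a)) (π b) = 0 ∧ wedge K (π b) ((al K ^ k) (π a)) = 0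
    rw [← π.map_al_pow, ← hφ, ← hφ]
    exact ⟨hφ0 _ ((hq0 _).1 ((q.map_br _ _).trans h₁)),
      hφ0 _ ((hq0 _).1 ((q.map_br _ _).trans h₂))⟩

end FreePresentations

/-! ### Quotients by central subalgebras -/

section CentralQuotients

variable {K : Type u} [Field K] {g : Type v} [AddCommGroup g] [Module K g] [HomLeibniz K g]

theorem tensorMap_injective_iff (n : Submodule K g) (hn : IsIdeal n) :
    Function.Injective (tensorMap (Quo.mk n hn)) ↔ n ≤ tensorCenter K g := by
  constructor
  · intro h x hx k y
    have hk : (Quo.mk n hn) ((al K ^ k) x) = 0 :=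
      (Submodule.Quotient.mk_eq_zero n).2 (al_pow_mem hn.al_mem k hx)
    have h0 : tensorMap (Quo.mk n hn) 0 = 0 := map_zero (tensorMap (Quo.mk n hn)).toLinearMap
    refine ⟨⟨h ?_, h ?_⟩, h ?_, h ?_⟩ <;> rw [h0]
    · rw [tensorMap_tmn, hk]; exact (tmnB K).map_zero₂ _
    · rw [tensorMap_tmn, hk]; exact (tmnB K _).map_zero
    · rw [tensorMap_tnm, hk]; exact (tnmB K).map_zero₂ _
    · rw [tensorMap_tnm, hk]; exact (tnmB K _).map_zero
  · intro h
    obtain ⟨φ, hφ⟩ := exists_factor_tensorMap (f := Quo.mk n hn) n.mkQ_surjective LinearMap.id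
      fun x hx y => h ((Submodule.Quotient.mk_eq_zero n).1 hx) 0 y
    exact Function.LeftInverse.injective hφ

theorem extMap_injective_iff (n : Submodule K g) (hn : IsIdeal n) :
    Function.Injective (extMap (Quo.mk n hn)) ↔ n ≤ extCenter K g := by
  constructor
  · intro h x hx k y
    have hk : (Quo.mk n hn) ((al K ^ k) x) = 0 :=
      (Submodule.Quotient.mk_eq_zero n).2 (al_pow_mem hn.al_mem k hx)
    have h0 : extMap (Quo.mk n hn) 0 = 0 := map_zero (extMap (Quo.mk n hn)).toLinearMap
    refine ⟨h ?_, h ?_⟩ <;> rw [h0]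
    · rw [extMap_wedge, hk, map_zero, LinearMap.zero_apply]
    · rw [extMap_wedge, hk, map_zero]
  · intro h
    obtain ⟨φ, hφ⟩ := exists_factor_extMap (f := Quo.mk n hn) n.mkQ_surjective LinearMap.id
      fun x hx y => h ((Submodule.Quotient.mk_eq_zero n).1 hx) 0 y
    exact Function.LeftInverse.injective hφ

theorem JL2map_injective_iff (n : Submodule K g) (hn : IsCentralSubalgebra n) :
    Function.Injective (JL2map (Quo.mk n hn.isIdeal)) ↔
      Function.Bijective (tensorMap (Quo.mk n hn.isIdeal)) := by
  set f := Quo.mk n hn.isIdeal with hf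
  have hs : Function.Surjective f := n.mkQ_surjective
  refine ⟨fun h => ⟨?_, tensorMap_surjective hs⟩,
    fun h u v huv => Subtype.ext (h.1 (congrArg Subtype.val huv))⟩
  obtain ⟨φ, hφ⟩ := exists_factor_tensorMap hs (lam K g).toLinearMap fun x hx y => by
    have hx' := hn.le_center ((Submodule.Quotient.mk_eq_zero n).1 hx) y
    exact ⟨hx', hx'⟩
  refine (injective_iff_map_eq_zero (tensorMap f).toLinearMap).2 fun u hu => ?_
  have hl : u ∈ JL2 K g :=
    LinearMap.mem_ker.2 ((hφ u).symm.trans ((congrArg φ hu).trans (map_zero φ)))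
  have : (⟨u, hl⟩ : JL2 K g) = 0 := h ((Subtype.ext hu).trans (map_zero _).symm)
  exact congrArg Subtype.val this

/-- As `HL₂(g)` is the kernel of `g ∧ g → g`, the map `HL₂(g) → HL₂(h)` is the restriction of
`extMap f`. -/
theorem HL2map_injective_iff_forall {h : Type w} [AddCommGroup h] [Module K h] [HomLeibniz K h]
    (f : Hom K g h) :
    Function.Injective (HL2map f) ↔ ∀ u, extLam K g u = 0 → extMap f u = 0 → u = 0 := by
  have hcomm : ∀ z, toExt K h (TensorProduct.map f.toLinearMap f.toLinearMap z)
      = extMap f (toExt K g z) := by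
    have : toExt K h ∘ₗ TensorProduct.map f.toLinearMap f.toLinearMap
        = (extMap f).toLinearMap ∘ₗ toExt K g := TensorProduct.ext' fun x y => rfl
    exact LinearMap.congr_fun this
  have hzero : ∀ z : LinearMap.ker (d2 K g),
      (Submodule.Quotient.mk z : HL2 K g) = 0 ↔ toExt K g z = 0 := fun z => by
    rw [Submodule.Quotient.mk_eq_zero, ← ker_toExt]
    exact Iff.rfl
  have hmap : ∀ z : LinearMap.ker (d2 K g),
      HL2map f (Submodule.Quotient.mk z : HL2 K g) = 0 ↔ extMap f (toExt K g z) = 0 := fun z => by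
    rw [← hcomm]
    refine (Submodule.Quotient.mk_eq_zero _).trans ?_
    rw [← ker_toExt]
    exact Iff.rfl
  rw [injective_iff_map_eq_zero]
  constructor
  · intro h u hu hfu
    obtain ⟨z, rfl⟩ := toExt_surjective u
    rw [extLam_toExt] at hu
    exact (hzero ⟨z, hu⟩).1 (h _ ((hmap ⟨z, hu⟩).2 hfu))
  · intro h u hu
    obtain ⟨z, rfl⟩ := Submodule.Quotient.mk_surjective _ u
    exact (hzero z).2 (h _ ((extLam_toExt _).trans z.2) ((hmap z).1 hu))

theorem HL2map_injective_iff (n : Submodule K g) (hn : IsCentralSubalgebra n) :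
    Function.Injective (HL2map (Quo.mk n hn.isIdeal)) ↔
      Function.Bijective (extMap (Quo.mk n hn.isIdeal)) := by
  have hs : Function.Surjective (Quo.mk n hn.isIdeal) := n.mkQ_surjective
  rw [HL2map_injective_iff_forall]
  refine ⟨fun h => ⟨?_, extMap_surjective hs⟩, fun h u _ hu =>
    h.1 (hu.trans (map_zero (extMap (Quo.mk n hn.isIdeal)).toLinearMap).symm)⟩
  obtain ⟨φ, hφ⟩ := exists_factor_extMap hs (extLam K g) fun x hx y =>
    hn.le_center ((Submodule.Quotient.mk_eq_zero n).1 hx) y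
  refine (injective_iff_map_eq_zero (extMap (Quo.mk n hn.isIdeal)).toLinearMap).2 fun u hu => ?_
  exact h u ((hφ u).symm.trans ((congrArg φ hu).trans (map_zero φ))) hu

end CentralQuotients

end HomLeibniz

theorem proposition5p4 (K : Type u) [Field K] (g : Type v) [AddCommGroup g] [Module K g]
    [HomLeibniz K g] :
    -- (i)
    (HomLeibniz.IsCentralIdeal (HomLeibniz.tensorCenter K g) ∧
      HomLeibniz.IsCentralIdeal (HomLeibniz.extCenter K g)) ∧
    -- (ii)
    (Function.Surjective (HomLeibniz.al K : g →ₗ[K] g) →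
      HomLeibniz.tensorCenter K g ≤ HomLeibniz.commutator ⊤ ⊤ ∧
      HomLeibniz.extCenter K g ≤ HomLeibniz.commutator ⊤ ⊤) ∧
    -- (iii)
    (∀ (F : Type w) [AddCommGroup F] [Module K F] [HomLeibniz K F],
      HomLeibniz.IsFree.{u, w, w'} K F →
      ∀ π : HomLeibniz.Hom K F g, Function.Surjective π →
        HomLeibniz.extCenter K g =
          (HomLeibniz.alphaCenter K (HomLeibniz.CentralQuo π)).map
            (HomLeibniz.piBar π).toLinearMap) ∧
    -- (iv)
    (IsLeast
        {c : Submodule K g | HomLeibniz.IsCentralSubalgebra c ∧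
          ∀ (n : Submodule K g) (hn : HomLeibniz.IsCentralSubalgebra n),
            Function.Injective (HomLeibniz.HL2map (HomLeibniz.Quo.mk n hn.isIdeal)) → n ≤ c}
        (HomLeibniz.extCenter K g) ∧
      ∀ (n : Submodule K g) (hn : HomLeibniz.IsCentralSubalgebra n),
        Function.Injective (HomLeibniz.HL2map (HomLeibniz.Quo.mk n hn.isIdeal)) ↔
          Function.Bijective (HomLeibniz.extMap (HomLeibniz.Quo.mk n hn.isIdeal))) ∧
    -- (v)
    (IsLeast
        {c : Submodule K g | HomLeibniz.IsCentralSubalgebra c ∧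
          ∀ (n : Submodule K g) (hn : HomLeibniz.IsCentralSubalgebra n),
            Function.Injective (HomLeibniz.JL2map (HomLeibniz.Quo.mk n hn.isIdeal)) → n ≤ c}
        (HomLeibniz.tensorCenter K g) ∧
      ∀ (n : Submodule K g) (hn : HomLeibniz.IsCentralSubalgebra n),
        Function.Injective (HomLeibniz.JL2map (HomLeibniz.Quo.mk n hn.isIdeal)) ↔
          Function.Bijective (HomLeibniz.tensorMap (HomLeibniz.Quo.mk n hn.isIdeal))) := by
  refine ⟨⟨HomLeibniz.isCentralIdeal_tensorCenter, HomLeibniz.isCentralIdeal_extCenter⟩,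
    fun _ => ⟨HomLeibniz.tensorCenter_le_extCenter.trans HomLeibniz.extCenter_le_commutator,
      HomLeibniz.extCenter_le_commutator⟩,
    fun F _ _ _ hF π hπ => HomLeibniz.extCenter_eq_map_piBar hF π hπ,
    ⟨⟨⟨HomLeibniz.isCentralIdeal_extCenter.isCentralSubalgebra, fun n hn h => ?_⟩,
      fun c hc => hc.2 _ HomLeibniz.isCentralIdeal_extCenter.isCentralSubalgebra ?_⟩,
      HomLeibniz.HL2map_injective_iff⟩,
    ⟨⟨HomLeibniz.isCentralIdeal_tensorCenter.isCentralSubalgebra, fun n hn h => ?_⟩,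
      fun c hc => hc.2 _ HomLeibniz.isCentralIdeal_tensorCenter.isCentralSubalgebra ?_⟩,
    HomLeibniz.JL2map_injective_iff⟩
  · exact (HomLeibniz.extMap_injective_iff n hn.isIdeal).1
      ((HomLeibniz.HL2map_injective_iff n hn).1 h).1
  · exact (HomLeibniz.HL2map_injective_iff _
      HomLeibniz.isCentralIdeal_extCenter.isCentralSubalgebra).2
      ⟨(HomLeibniz.extMap_injective_iff _ _).2 le_rfl,
        HomLeibniz.extMap_surjective (Submodule.mkQ_surjective _)⟩
  · exact (HomLeibniz.tensorMap_injective_iff n hn.isIdeal).1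
      ((HomLeibniz.JL2map_injective_iff n hn).1 h).1
  · exact (HomLeibniz.JL2map_injective_iff _
      HomLeibniz.isCentralIdeal_tensorCenter.isCentralSubalgebra).2
      ⟨(HomLeibniz.tensorMap_injective_iff _ _).2 le_rfl,
        HomLeibniz.tensorMap_surjective (Submodule.mkQ_surjective _)⟩
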